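/- For a finite set $A\subset\mathbf{Z}$ write $\widehat{1_A}(\theta)=\sum_{n\in A}e^{-2\pi i n\theta}$ and $\|\widehat{1_A}\|_1=\int_0^1|\widehat{1_A}(\theta)|\,d\theta$. There is an absolute constant $N_0$ such that for every real $K>0$ there is a constant $c_K>0$, depending only on $K$, with the following property. If $N\ge N_0$ is a positive integer and $A\subset\mathbf{Z}$ is a finite set with $|A|=N$ and $\|\widehat{1_A}\|_1\le K\log N$, then there is an arithmetic progression $P\subset\mathbf{Z}$ with positive common difference, of length (number of terms) at least $N^{c_K}$, such that $|A\cap P|\ge c_K|P|$. -/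

import Mathlib

/-- The Fourier transform `θ ↦ ∑_{n ∈ A} e(-nθ)`, with `e(x) = exp(2πix)`, of the indicator function
of a finite set `A` of integers. It is `1`-periodic, so a function on `ℝ / ℤ`. -/
noncomputable def fourierIndicator (A : Finset ℤ) (θ : ℝ) : ℂ :=
  ∑ n ∈ A, Complex.exp (2 * (Real.pi : ℂ) * Complex.I * (-((n : ℂ) * (θ : ℂ))))

/-- The `L¹` norm over one period of the Fourier transform of the indicator function of `A`. The
integrand is continuous, so the integral is never a default value. -/
noncomputable def fourierL1Norm (A : Finset ℤ) : ℝ :=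
  ∫ θ in (0 : ℝ)..1, ‖fourierIndicator A θ‖

/-- `P` is an arithmetic progression of integers with `L` terms `a, a + d, …, a + (L - 1) d`, where
the common difference `d` is positive; hence the terms are distinct and `P` has `L` elements. -/
def IsArithmeticProgression (P : Finset ℤ) (L : ℕ) : Prop :=
  ∃ a d : ℤ, 0 < d ∧ P = (Finset.range L).image (fun i : ℕ => a + (i : ℤ) * d)

/-!
A refinement of the McGehee–Pigno–Smith argument shows that a small `L¹` norm forces large additive
energy, and classical additive combinatorics then produces the progression.

*From the norm to the energy.* Let `B j` be the initial segment of `A` with `4 ^ j` elements, `f j`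
its exponential sum and `x j = M |f j| / 4 ^ j`, where `M` is a large multiple of `K`. In the original
argument one builds a bounded test function out of the `f j / 4 ^ j`, and every scale contributes a
constant to its correlation with `A`. If every `B j` has small additive energy, then `f j` is rarely
of the order of its maximum, and the larger function `M f j / 4 ^ j` can be cut down to a bounded
function by a factor `exp (-H j)` which changes it little in mean square. Here `H j` has real part at
least `x j ^ 2` and non-positive frequencies, so the product still has no frequency above `max (B j)`
and its correlation with `A` only sees `B j`. The terms are assembled, as in the original argument,
into `∑ j, (M f j / 4 ^ j) exp (-H j - ∑ k > j, h k)` with `Re (h k) ≥ x k`; this is bounded by `2`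
(`norm_sum_mul_exp_neg_le`). The deviation of the exponential from `1` is controlled by the
Cauchy–Schwarz inequality, with the energy as fourth moment of `f j`, and each scale contributes at
least `M / 2` (`le_fourierL1Norm_of_addEnergy_le`). There are about `log |A|` scales with
`4 ^ j ≥ |A| ^ (1 / 4)`, so a norm of at most `K log |A|` is impossible unless one of these `B j` has
additive energy at least a constant times `|B j| ^ 3` (`exists_subset_le_addEnergy`).

*From the energy to the progression.* The Balog–Szemerédi–Gowers theorem
(`exists_subset_card_sub_le`) gives a large subset of `B j` with small difference set, whose iterated
sum and difference sets are small by the Plünnecke–Ruzsa inequality. Ruzsa's modelling lemma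
(`exists_freiman_model`) transfers the subset to a dense subset of `ℤ / qℤ`, where Bogolyubov's lemma
and Dirichlet's approximation theorem (`exists_progression_zmod`) give a progression in `2S - 2S`.
It lifts to the integers (`exists_progression_subset`), and an averaging argument shows that the set
is dense on one of its translates (`exists_translate_dense`).
-/

/-! ### Functions on the circle with non-positive frequencies -/

section

open AddCircle MeasureTheory
open scoped ComplexConjugate

/-- The mean over the circle `ℝ / ℤ`, as a continuous linear functional on `C(ℝ / ℤ, ℂ)`. -/
noncomputable def circleMean : C(UnitAddCircle, ℂ) →L[ℂ] ℂ :=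
  LinearMap.mkContinuous
    { toFun := fun F => ∫ t, F t ∂haarAddCircle
      map_add' := fun F G => integral_add
        (F.continuous.integrable_of_hasCompactSupport (HasCompactSupport.of_compactSpace F))
        (G.continuous.integrable_of_hasCompactSupport (HasCompactSupport.of_compactSpace G))
      map_smul' := fun c F => integral_const_mul c F } 1
    (fun F => by
      have h := norm_integral_le_of_norm_le_const (μ := haarAddCircle (T := (1 : ℝ)))
        (Filter.Eventually.of_forall F.norm_coe_le_norm)
      simpa using h)

lemma circleMean_apply (F : C(UnitAddCircle, ℂ)) : circleMean F = ∫ t, F t ∂haarAddCircle := rfl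

lemma circleMean_fourier (n : ℤ) :
    circleMean (fourier n) = if n = 0 then 1 else 0 := by
  have h := congrFun (fourierCoeff_fourier (T := (1 : ℝ)) n) 0
  rw [fourierCoeff] at h
  simp only [neg_zero, fourier_zero, one_smul] at h
  rw [circleMean_apply, h, Pi.single_apply]
  simp [eq_comm]

lemma integrable_of_continuous {E : Type*} [NormedAddCommGroup E]
    {f : UnitAddCircle → E} (hf : Continuous f) : Integrable f haarAddCircle :=
  hf.integrable_of_hasCompactSupport (HasCompactSupport.of_compactSpace f)

lemma fourier_mul_fourier (m n : ℤ) :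
    (fourier m * fourier n : C(UnitAddCircle, ℂ)) = fourier (m + n) := by
  ext t; exact fourier_add.symm

lemma fourier_neg_one_pow (n : ℕ) :
    (fourier (-1) : C(UnitAddCircle, ℂ)) ^ n = fourier (-(n : ℤ)) := by
  induction n with
  | zero => ext t; simp
  | succ n ih => rw [pow_succ, ih, fourier_mul_fourier]; congr 1; push_cast; ring

/-- The conjugate disc algebra: the closed subalgebra of `C(ℝ / ℤ, ℂ)` generated by
`t ↦ e(-t)`, i.e. the continuous functions all of whose frequencies are non-positive. -/
noncomputable def antiDiscAlgebra : Subalgebra ℂ C(UnitAddCircle, ℂ) :=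
  (Algebra.adjoin ℂ {fourier (-1)}).topologicalClosure

lemma fourier_neg_mem_antiDiscAlgebra (n : ℕ) :
    fourier (-(n : ℤ)) ∈ antiDiscAlgebra := by
  rw [← fourier_neg_one_pow]
  exact pow_mem (Subalgebra.le_topologicalClosure _ (Algebra.self_mem_adjoin_singleton _ _)) n

lemma isClosed_antiDiscAlgebra : IsClosed (antiDiscAlgebra : Set C(UnitAddCircle, ℂ)) :=
  Subalgebra.isClosed_topologicalClosure _

lemma circleMean_aeval (p : Polynomial ℂ) :
    circleMean (Polynomial.aeval (fourier (-1) : C(UnitAddCircle, ℂ)) p) = p.eval 0 := by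
  induction p using Polynomial.induction_on' with
  | add p q hp hq => simp only [map_add, hp, hq, Polynomial.eval_add]
  | monomial n a =>
    rw [Polynomial.aeval_monomial, fourier_neg_one_pow, Algebra.algebraMap_eq_smul_one,
      smul_mul_assoc, one_mul, map_smul, circleMean_fourier]
    rcases Nat.eq_zero_or_pos n with rfl | hn
    · simp
    · simp [hn.ne']

/-- The mean is multiplicative on functions with non-positive frequencies. -/
lemma circleMean_mul {F G : C(UnitAddCircle, ℂ)} (hF : F ∈ antiDiscAlgebra)
    (hG : G ∈ antiDiscAlgebra) : circleMean (F * G) = circleMean F * circleMean G := by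
  have key : ∀ F ∈ Algebra.adjoin ℂ {(fourier (-1) : C(UnitAddCircle, ℂ))},
      ∀ G ∈ Algebra.adjoin ℂ {(fourier (-1) : C(UnitAddCircle, ℂ))},
      circleMean (F * G) = circleMean F * circleMean G := by
    intro F hF G hG
    rw [Algebra.adjoin_singleton_eq_range_aeval] at hF hG
    obtain ⟨p, rfl⟩ := hF
    obtain ⟨q, rfl⟩ := hG
    simp only [AlgHom.toRingHom_eq_coe, RingHom.coe_coe]
    rw [← map_mul, circleMean_aeval, circleMean_aeval, circleMean_aeval, Polynomial.eval_mul]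
  have key2 : ∀ F ∈ Algebra.adjoin ℂ {(fourier (-1) : C(UnitAddCircle, ℂ))},
      ∀ G ∈ antiDiscAlgebra, circleMean (F * G) = circleMean F * circleMean G := by
    intro F hF
    exact closure_minimal (key F hF) (isClosed_eq (by fun_prop) (by fun_prop))
  have key3 : ∀ F ∈ antiDiscAlgebra, circleMean (F * G) = circleMean F * circleMean G :=
    closure_minimal (fun F hF => key2 F hF G hG) (isClosed_eq (by fun_prop) (by fun_prop))
  exact key3 F hF

lemma circleMean_fourier_mul_eq_zero {n : ℤ} (hn : n < 0) {F : C(UnitAddCircle, ℂ)}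
    (hF : F ∈ antiDiscAlgebra) : circleMean (fourier n * F) = 0 := by
  obtain ⟨m, rfl⟩ : ∃ m : ℕ, n = -(m : ℤ) := ⟨n.natAbs, by omega⟩
  rw [circleMean_mul (fourier_neg_mem_antiDiscAlgebra m) hF, circleMean_fourier, if_neg hn.ne,
    zero_mul]

lemma exp_mem_antiDiscAlgebra {F : C(UnitAddCircle, ℂ)} (hF : F ∈ antiDiscAlgebra) :
    ∃ G ∈ antiDiscAlgebra, ∀ t, G t = Complex.exp (F t) := by
  refine ⟨NormedSpace.exp F, NormedSpace.exp_mem isClosed_antiDiscAlgebra hF, fun t => ?_⟩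
  have := NormedSpace.map_exp (ContinuousMap.evalAlgHom ℂ ℂ t)
    (continuous_eval_const t) F
  rw [Complex.exp_eq_exp_ℂ]
  exact this

/-- Every trigonometric polynomial is the sum of a function with non-positive frequencies and the
conjugate of such a function. -/
lemma exists_eq_add_conj_of_mem_span {p : C(UnitAddCircle, ℂ)}
    (hp : p ∈ Submodule.span ℂ (Set.range (fourier (T := (1 : ℝ))))) :
    ∃ h ∈ antiDiscAlgebra, ∃ k ∈ antiDiscAlgebra, ∀ t, p t = h t + conj (k t) := by
  induction hp using Submodule.span_induction with
  | mem x hx =>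
    obtain ⟨n, rfl⟩ := hx
    rcases le_total n 0 with hn | hn
    · refine ⟨fourier n, ?_, 0, zero_mem _, fun t => by simp⟩
      have := fourier_neg_mem_antiDiscAlgebra n.natAbs
      rwa [show -(n.natAbs : ℤ) = n by omega] at this
    · refine ⟨0, zero_mem _, fourier (-n), ?_, fun t => by rw [fourier_neg]; simp⟩
      have := fourier_neg_mem_antiDiscAlgebra n.natAbs
      rwa [show -(n.natAbs : ℤ) = -n by omega] at this
  | zero => exact ⟨0, zero_mem _, 0, zero_mem _, fun t => by simp⟩
  | add x y _ _ hx hy =>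
    obtain ⟨h, hh, k, hk, hx⟩ := hx
    obtain ⟨h', hh', k', hk', hy⟩ := hy
    exact ⟨h + h', add_mem hh hh', k + k', add_mem hk hk', fun t => by simp [hx, hy]; ring⟩
  | smul a x _ hx =>
    obtain ⟨h, hh, k, hk, hx⟩ := hx
    exact ⟨a • h, Subalgebra.smul_mem _ hh a, conj a • k, Subalgebra.smul_mem _ hk _,
      fun t => by simp [hx]; ring⟩

/-- If a function `h` with non-positive frequencies has real mean, its imaginary part is no larger
than its real part in `L²`, because the mean of `h ^ 2` is the square of a real number. -/
lemma integral_normSq_le {h : C(UnitAddCircle, ℂ)} (hh : h ∈ antiDiscAlgebra)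
    (him : (circleMean h).im = 0) :
    ∫ t, ‖h t‖ ^ 2 ∂haarAddCircle ≤ 2 * ∫ t, (h t).re ^ 2 ∂haarAddCircle := by
  have hc : Continuous h := h.continuous
  have h1 : 0 ≤ (circleMean (h * h)).re := by
    rw [circleMean_mul hh hh, Complex.mul_re, him]
    nlinarith [mul_self_nonneg (circleMean h).re]
  have h2 : (circleMean (h * h)).re = ∫ t, ((h t).re ^ 2 - (h t).im ^ 2) ∂haarAddCircle := by
    rw [circleMean_apply]
    have := integral_re (𝕜 := ℂ) (μ := haarAddCircle (T := (1 : ℝ)))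
      (integrable_of_continuous (h * h).continuous)
    simp only [RCLike.re_to_complex] at this
    rw [← this]
    refine integral_congr_ae (Filter.Eventually.of_forall fun t => ?_)
    simp [Complex.mul_re]; ring
  have h3 : ∫ t, ‖h t‖ ^ 2 ∂haarAddCircle
      = 2 * ∫ t, (h t).re ^ 2 ∂haarAddCircle
        - ∫ t, ((h t).re ^ 2 - (h t).im ^ 2) ∂haarAddCircle := by
    rw [← integral_const_mul, ← integral_sub]
    · refine integral_congr_ae (Filter.Eventually.of_forall fun t => ?_)
      simp only [Complex.sq_norm, Complex.normSq_apply]; ring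
    · exact integrable_of_continuous (by fun_prop)
    · exact integrable_of_continuous (by fun_prop)
  linarith

/-- A continuous function `g` is dominated by the real part of a function with non-positive
frequencies whose `L²` norm is comparable to that of `g`. -/
lemma exists_antiDiscAlgebra_majorant {g : UnitAddCircle → ℝ} (hg : Continuous g)
    (hg0 : ∀ t, 0 ≤ g t) (hpos : 0 < ∫ t, g t ^ 2 ∂haarAddCircle) :
    ∃ h ∈ antiDiscAlgebra, (∀ t, g t ≤ (h t).re) ∧
      ∫ t, ‖h t‖ ^ 2 ∂haarAddCircle ≤ 8 * ∫ t, g t ^ 2 ∂haarAddCircle := by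
  set I := ∫ t, g t ^ 2 ∂haarAddCircle with hI
  set η : ℝ := Real.sqrt I with hη
  have hηpos : 0 < η := Real.sqrt_pos.2 hpos
  have hηsq : η ^ 2 = I := Real.sq_sqrt hpos.le
  -- Approximating `g + η / 2` by a trigonometric polynomial up to `η / 2` keeps it above `g`.
  let G : C(UnitAddCircle, ℂ) := ⟨fun t => ((g t + η / 2 : ℝ) : ℂ), by fun_prop⟩
  have hG : G ∈ closure
      ((Submodule.span ℂ (Set.range (fourier (T := (1 : ℝ))))) : Set C(UnitAddCircle, ℂ)) := by
    rw [← Submodule.topologicalClosure_coe, span_fourier_closure_eq_top]; trivial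
  obtain ⟨p, hp, hpG⟩ := Metric.mem_closure_iff.1 hG (η / 2) (by positivity)
  have hclose : ∀ t, |g t + η / 2 - (p t).re| ≤ η / 2 := by
    intro t
    have h1 : ‖G t - p t‖ ≤ η / 2 := by
      rw [← dist_eq_norm]
      exact (ContinuousMap.dist_apply_le_dist t).trans hpG.le
    have h2 := (Complex.abs_re_le_norm (G t - p t)).trans h1
    simpa [G] using h2
  obtain ⟨h, hh, k, hk, hp⟩ := exists_eq_add_conj_of_mem_span hp
  -- Subtracting the imaginary part of the mean leaves the real part unchanged.
  let c : ℂ := Complex.I * ((circleMean (h + k)).im : ℂ)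
  have hre : ∀ t, ((h + k - algebraMap ℂ C(UnitAddCircle, ℂ) c) t).re = (p t).re := by
    intro t
    simp [hp, c]
  refine ⟨h + k - algebraMap ℂ _ c,
    sub_mem (add_mem hh hk) (Subalgebra.algebraMap_mem _ c), ?_, ?_⟩
  · intro t
    rw [hre]
    linarith [(abs_le.1 (hclose t)).2]
  · refine (integral_normSq_le (sub_mem (add_mem hh hk) (Subalgebra.algebraMap_mem _ c)) ?_).trans ?_
    · have : circleMean (algebraMap ℂ C(UnitAddCircle, ℂ) c) = c := by
        simp [circleMean_apply]
      rw [map_sub, this]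
      simp [c]
    · have hb : ∀ t, ((h + k - algebraMap ℂ C(UnitAddCircle, ℂ) c) t).re ^ 2
          ≤ 2 * g t ^ 2 + 2 * η ^ 2 := by
        intro t
        rw [hre]
        have h1 := abs_le.1 (hclose t)
        nlinarith [hg0 t, sq_nonneg (g t - η)]
      have hm : ∫ t, ((h + k - algebraMap ℂ C(UnitAddCircle, ℂ) c) t).re ^ 2 ∂haarAddCircle
          ≤ ∫ t, (2 * g t ^ 2 + 2 * η ^ 2) ∂haarAddCircle := by
        refine integral_mono (integrable_of_continuous ?_) (integrable_of_continuous ?_) hb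
        · exact (Complex.continuous_re.comp (ContinuousMap.continuous _)).pow 2
        · fun_prop
      rw [integral_add (integrable_of_continuous (by fun_prop))
        (integrable_of_continuous (by fun_prop)), integral_const_mul, integral_const, ← hI,
        hηsq] at hm
      rw [probReal_univ, one_smul] at hm
      linarith

end

/-! ### Exponential sums and the bounded test function -/

section

open AddCircle MeasureTheory
open scoped ComplexConjugate

/-- The exponential sum `∑ b ∈ B, e(b t)`, the complex conjugate of `fourierIndicator B`. -/
noncomputable def expSum (B : Finset ℤ) : C(UnitAddCircle, ℂ) := ∑ b ∈ B, fourier b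

lemma star_fourier (n : ℤ) : star (fourier n : C(UnitAddCircle, ℂ)) = fourier (-n) := by
  ext t
  rw [fourier_neg]
  rfl

lemma star_expSum (B : Finset ℤ) : star (expSum B) = ∑ b ∈ B, fourier (-b) := by
  simp [expSum, star_sum, star_fourier]

lemma circleMean_sum_fourier {ι : Type*} (s : Finset ι) (g : ι → ℤ) :
    circleMean (∑ i ∈ s, fourier (g i)) = (s.filter fun i => g i = 0).card := by
  simp [map_sum, circleMean_fourier]

lemma expSum_mul_star (B : Finset ℤ) :
    expSum B * star (expSum B) = ∑ x ∈ B ×ˢ B, fourier (x.1 - x.2) := by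
  rw [star_expSum, expSum, Finset.sum_mul_sum, Finset.sum_product]
  simp [fourier_mul_fourier, sub_eq_add_neg]

lemma ofReal_norm_expSum_sq (B : Finset ℤ) (t : UnitAddCircle) :
    ((‖expSum B t‖ ^ 2 : ℝ) : ℂ) = (expSum B * star (expSum B)) t := by
  have := Complex.mul_conj (expSum B t)
  rw [← Complex.sq_norm] at this
  exact this.symm

lemma integral_norm_expSum_sq (B : Finset ℤ) :
    ∫ t, ‖expSum B t‖ ^ 2 ∂haarAddCircle = B.card := by
  have h : circleMean (expSum B * star (expSum B)) = B.card := by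
    rw [expSum_mul_star, circleMean_sum_fourier]
    congr 1
    rw [← Finset.diag_card B, Finset.diag]
    congr 1
    ext ⟨x, y⟩
    simp only [Finset.mem_filter, Finset.mem_product, sub_eq_zero, Finset.mem_map,
      Function.Embedding.coeFn_mk]
    grind
  rw [circleMean_apply] at h
  simp_rw [← ofReal_norm_expSum_sq] at h
  rw [integral_complex_ofReal] at h
  exact_mod_cast h

lemma integral_norm_expSum_pow_four (B : Finset ℤ) :
    ∫ t, (‖expSum B t‖ ^ 2) ^ 2 ∂haarAddCircle = B.addEnergy B := by
  have h : circleMean ((expSum B * star (expSum B)) ^ 2) = B.addEnergy B := by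
    rw [expSum_mul_star, sq, Finset.sum_mul_sum, ← Finset.sum_product']
    simp_rw [fourier_mul_fourier]
    rw [circleMean_sum_fourier, Finset.addEnergy]
    norm_cast
    refine Finset.card_bij' (fun x _ => x) (fun x _ => x) ?_ ?_ (fun _ _ => rfl) (fun _ _ => rfl)
    all_goals
      intro x hx
      simp only [Finset.mem_filter, Finset.mem_product] at hx ⊢
      exact ⟨hx.1, by omega⟩
  rw [circleMean_apply] at h
  simp_rw [ContinuousMap.pow_apply, ← ofReal_norm_expSum_sq, ← Complex.ofReal_pow] at h
  rw [integral_complex_ofReal] at h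
  exact_mod_cast h

lemma fourierL1Norm_eq_integral_norm_expSum (A : Finset ℤ) :
    fourierL1Norm A = ∫ t, ‖expSum A t‖ ∂haarAddCircle := by
  rw [AddCircle.integral_haarAddCircle, inv_one, one_smul,
    ← UnitAddCircle.intervalIntegral_preimage 0, zero_add]
  refine intervalIntegral.integral_congr fun θ _ => ?_
  have : fourierIndicator A θ = conj (expSum A (θ : UnitAddCircle)) := by
    rw [fourierIndicator, expSum, ContinuousMap.sum_apply, map_sum]
    refine Finset.sum_congr rfl fun n _ => ?_
    rw [← fourier_neg, fourier_coe_apply]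
    congr 1
    push_cast
    ring
  simp only [this, RCLike.norm_conj]

/-- **Cauchy–Schwarz inequality** for continuous functions on the circle. -/
lemma sq_integral_mul_le {f g : UnitAddCircle → ℝ} (hf : Continuous f) (hg : Continuous g)
    (hf0 : ∀ t, 0 ≤ f t) (hg0 : ∀ t, 0 ≤ g t) :
    (∫ t, f t * g t ∂haarAddCircle) ^ 2
      ≤ (∫ t, f t ^ 2 ∂haarAddCircle) * ∫ t, g t ^ 2 ∂haarAddCircle := by
  have hmem : ∀ {u : UnitAddCircle → ℝ}, Continuous u →
      MemLp u (ENNReal.ofReal 2) haarAddCircle := fun {u} hu =>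
    hu.memLp_of_hasCompactSupport (HasCompactSupport.of_compactSpace u)
  have h := integral_mul_le_Lp_mul_Lq_of_nonneg (μ := haarAddCircle (T := (1 : ℝ)))
    Real.HolderConjugate.two_two
    (Filter.Eventually.of_forall hf0) (Filter.Eventually.of_forall hg0) (hmem hf) (hmem hg)
  simp only [Real.rpow_two, ← Real.sqrt_eq_rpow] at h
  have h0 : 0 ≤ ∫ t, f t * g t ∂haarAddCircle :=
    integral_nonneg fun t => mul_nonneg (hf0 t) (hg0 t)
  calc _ ≤ (_ : ℝ) ^ 2 := pow_le_pow_left₀ h0 h 2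
    _ = _ := by
      rw [mul_pow, Real.sq_sqrt (integral_nonneg fun t => sq_nonneg _),
        Real.sq_sqrt (integral_nonneg fun t => sq_nonneg _)]

lemma norm_one_sub_exp_neg_le {z : ℂ} (hz : 0 ≤ z.re) : ‖1 - Complex.exp (-z)‖ ≤ ‖z‖ := by
  have hconv : Convex ℝ {w : ℂ | 0 ≤ w.re} := convex_halfSpace_re_ge 0
  have h := hconv.norm_image_sub_le_of_norm_hasDerivWithin_le (𝕜 := ℂ)
    (f := fun w => Complex.exp (-w)) (f' := fun w => -Complex.exp (-w)) (C := 1) (x := z) (y := 0)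
    (fun w _ => by
      have := ((Complex.hasDerivAt_exp (-w)).comp w (hasDerivAt_neg w)).hasDerivWithinAt
        (s := {w : ℂ | 0 ≤ w.re})
      simpa [Function.comp_def] using this)
    (fun w hw => by
      rw [norm_neg, Complex.norm_exp]
      simpa using hw) hz (by simp)
  simpa using h

/-- The test function stays bounded by `2`: with each further term the previous sum is damped by a
factor `exp (-h J)` that makes room for the new term, as `2 e⁻ˣ + x exp (-x ^ 2) ≤ 2`. -/
lemma norm_sum_mul_exp_neg_le (z H h : ℕ → ℂ) (J : ℕ)
    (hH : ∀ j < J, ‖z j‖ ^ 2 ≤ (H j).re) (hh : ∀ j < J, ‖z j‖ ≤ (h j).re) :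
    ‖∑ j ∈ Finset.range J,
      z j * Complex.exp (-(H j + ∑ k ∈ Finset.Ico (j + 1) J, h k))‖ ≤ 2 := by
  induction J with
  | zero => simp
  | succ J ih =>
    have ih := ih (fun j hj => hH j (by omega)) (fun j hj => hh j (by omega))
    have hrec : ∑ j ∈ Finset.range (J + 1),
        z j * Complex.exp (-(H j + ∑ k ∈ Finset.Ico (j + 1) (J + 1), h k))
        = (∑ j ∈ Finset.range J,
            z j * Complex.exp (-(H j + ∑ k ∈ Finset.Ico (j + 1) J, h k))) * Complex.exp (-h J)
          + z J * Complex.exp (-H J) := by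
      rw [Finset.sum_range_succ, Finset.sum_mul]
      congr 1
      · refine Finset.sum_congr rfl fun j hj => ?_
        rw [Finset.sum_Ico_succ_top (by have := Finset.mem_range.1 hj; omega), mul_assoc,
          ← Complex.exp_add]
        congr 2
        ring
      · simp
    rw [hrec]
    have hx := hH J (by omega)
    have hy := hh J (by omega)
    set x := ‖z J‖ with hxdef
    have hx0 : 0 ≤ x := norm_nonneg _
    have h1 : ‖Complex.exp (-h J)‖ ≤ Real.exp (-x) := by
      rw [Complex.norm_exp]
      exact Real.exp_le_exp.2 (by simpa using hy)
    have h2 : ‖z J * Complex.exp (-H J)‖ ≤ x * Real.exp (-x ^ 2) := by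
      rw [norm_mul, Complex.norm_exp]
      exact mul_le_mul_of_nonneg_left (Real.exp_le_exp.2 (by simpa using hx)) hx0
    refine (norm_add_le _ _).trans ?_
    rw [norm_mul]
    have h3 : Real.exp (-x) ≤ 1 / (1 + x + x ^ 2 / 2) := by
      rw [Real.exp_neg, ← one_div]
      exact one_div_le_one_div_of_le (by positivity) (Real.quadratic_le_exp_of_nonneg hx0)
    have h4 : Real.exp (-x ^ 2) ≤ 1 / (1 + x ^ 2) := by
      rw [Real.exp_neg, ← one_div]
      exact one_div_le_one_div_of_le (by positivity) (by linarith [Real.add_one_le_exp (x ^ 2)])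
    have h5 : 2 * (1 / (1 + x + x ^ 2 / 2)) + x * (1 / (1 + x ^ 2)) ≤ 2 := by
      rw [mul_one_div, mul_one_div, div_add_div _ _ (by positivity) (by positivity),
        div_le_iff₀ (by positivity)]
      have e : 2 * ((1 + x + x ^ 2 / 2) * (1 + x ^ 2))
          - (2 * (1 + x ^ 2) + (1 + x + x ^ 2 / 2) * x) = x + 3 / 2 * x ^ 3 + x ^ 4 := by ring
      have : 0 ≤ x + 3 / 2 * x ^ 3 + x ^ 4 := by positivity
      linarith
    calc _ ≤ 2 * Real.exp (-x) + x * Real.exp (-x ^ 2) :=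
          add_le_add (mul_le_mul ih h1 (norm_nonneg _) (by norm_num)) h2
      _ ≤ 2 * (1 / (1 + x + x ^ 2 / 2)) + x * (1 / (1 + x ^ 2)) := by gcongr
      _ ≤ 2 := h5

/-- Correlating `expSum A` with a function whose frequencies do not exceed those of an initial
segment `B` of `A` only sees `B`. -/
lemma circleMean_expSum_mul_star {A B : Finset ℤ} (hBA : B ⊆ A)
    (hlt : ∀ a ∈ A \ B, ∀ b ∈ B, b < a) {W : C(UnitAddCircle, ℂ)} (hW : W ∈ antiDiscAlgebra) :
    circleMean (expSum B * W * star (expSum A)) = circleMean (expSum B * star (expSum B) * W) := by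
  have hsplit : expSum A = expSum (A \ B) + expSum B := (Finset.sum_sdiff hBA).symm
  have hzero : circleMean (expSum B * star (expSum (A \ B)) * W) = 0 := by
    rw [star_expSum, expSum, Finset.sum_mul_sum, Finset.sum_mul, map_sum]
    refine Finset.sum_eq_zero fun b hb => ?_
    rw [Finset.sum_mul, map_sum]
    refine Finset.sum_eq_zero fun a ha => ?_
    rw [fourier_mul_fourier]
    exact circleMean_fourier_mul_eq_zero (by linarith [hlt a ha b hb]) hW
  rw [hsplit, star_add, mul_right_comm, mul_add, add_mul, map_add, hzero, zero_add]

/-- If `B` is an initial segment of `A`, and `W = exp (-G)` with `G` having non-positive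
frequencies, the correlation of `expSum B * W` with `expSum A` is at least `|B|` up to an error
controlled by `∫ |expSum B|² |G|`. -/
lemma le_re_circleMean_expSum_mul {A B : Finset ℤ} (hBA : B ⊆ A)
    (hlt : ∀ a ∈ A \ B, ∀ b ∈ B, b < a) {W G : C(UnitAddCircle, ℂ)} (hW : W ∈ antiDiscAlgebra)
    (hWG : ∀ t, W t = Complex.exp (-G t)) (hG : ∀ t, 0 ≤ (G t).re) :
    B.card - ∫ t, ‖expSum B t‖ ^ 2 * ‖G t‖ ∂haarAddCircle
      ≤ (circleMean (expSum B * W * star (expSum A))).re := by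
  rw [circleMean_expSum_mul_star hBA hlt hW, ← integral_norm_expSum_sq B, ← integral_sub
    (integrable_of_continuous (by fun_prop)) (integrable_of_continuous (by fun_prop)),
    circleMean_apply]
  have hre := integral_re (𝕜 := ℂ) (μ := haarAddCircle (T := (1 : ℝ)))
    (integrable_of_continuous (expSum B * star (expSum B) * W).continuous)
  simp only [RCLike.re_to_complex] at hre
  rw [← hre]
  refine integral_mono (integrable_of_continuous (by fun_prop)) (integrable_of_continuous
    (Complex.continuous_re.comp (ContinuousMap.continuous _))) fun t => ?_
  have h1 : ((expSum B * star (expSum B) * W) t).re = ‖expSum B t‖ ^ 2 * (W t).re := by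
    rw [ContinuousMap.mul_apply, ← ofReal_norm_expSum_sq, Complex.re_ofReal_mul]
  have h2 : 1 - ‖G t‖ ≤ (W t).re := by
    have := (Complex.re_le_norm (1 - W t)).trans (hWG t ▸ norm_one_sub_exp_neg_le (hG t))
    simp only [Complex.sub_re, Complex.one_re] at this
    linarith
  show _ ≤ ((expSum B * star (expSum B) * W) t).re
  rw [h1]
  nlinarith [sq_nonneg ‖expSum B t‖]

end

/-! ### Small additive energy forces a large `L¹` norm -/

section

open AddCircle MeasureTheory
open scoped ComplexConjugate

/-- The two correction functions attached to a set `B` of `n` integers, normalised so that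
`x = M |expSum B| / n`: `H`, whose real part is at least `x ^ 2`, cuts `x` down to a bounded
function, and `h`, whose real part is at least `x`, damps the terms of the preceding scales. -/
lemma exists_corrections {B : Finset ℤ} (hB : B.Nonempty) {M : ℝ} (hM : 0 < M) :
    ∃ H ∈ antiDiscAlgebra, ∃ h ∈ antiDiscAlgebra,
      (∀ t, (M / B.card * ‖expSum B t‖) ^ 2 ≤ (H t).re) ∧
      (∀ t, M / B.card * ‖expSum B t‖ ≤ (h t).re) ∧
      ∫ t, ‖H t‖ ^ 2 ∂haarAddCircle ≤ 8 * ((M / B.card) ^ 4 * B.addEnergy B) ∧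
      ∫ t, ‖h t‖ ^ 2 ∂haarAddCircle ≤ 8 * (M ^ 2 / B.card) := by
  have hn : (0 : ℝ) < B.card := by exact_mod_cast hB.card_pos
  have hE : (0 : ℝ) < B.addEnergy B := by exact_mod_cast Finset.addEnergy_pos hB hB
  have e1 : ∫ t, ((M / B.card * ‖expSum B t‖) ^ 2) ^ 2 ∂haarAddCircle
      = (M / B.card) ^ 4 * B.addEnergy B := by
    rw [← integral_norm_expSum_pow_four, ← integral_const_mul]
    congr 1; ext t; ring
  have e2 : ∫ t, (M / B.card * ‖expSum B t‖) ^ 2 ∂haarAddCircle = M ^ 2 / B.card := by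
    have : M ^ 2 / B.card = (M / B.card) ^ 2 * (B.card : ℝ) := by field_simp
    rw [this, ← integral_norm_expSum_sq, ← integral_const_mul]
    congr 1; ext t; ring
  obtain ⟨H, hH, hHg, hHi⟩ := exists_antiDiscAlgebra_majorant
    (g := fun t => (M / B.card * ‖expSum B t‖) ^ 2) (by fun_prop) (fun t => sq_nonneg _)
    (by rw [e1]; positivity)
  obtain ⟨h, hh, hhg, hhi⟩ := exists_antiDiscAlgebra_majorant
    (g := fun t => M / B.card * ‖expSum B t‖) (by fun_prop) (fun t => by positivity)
    (by rw [e2]; positivity)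
  exact ⟨H, hH, h, hh, hHg, hhg, e1 ▸ hHi, e2 ▸ hhi⟩

/-- The Cauchy–Schwarz inequality against `|expSum B| ^ 2`, whose `L²` norm is the square root of the
additive energy. -/
lemma integral_sq_mul_norm_le {B : Finset ℤ} {h : C(UnitAddCircle, ℂ)} {I c : ℝ} (hc : 0 ≤ c)
    (hI : ∫ t, ‖h t‖ ^ 2 ∂haarAddCircle ≤ I) (hle : B.addEnergy B * I ≤ c ^ 2) :
    ∫ t, ‖expSum B t‖ ^ 2 * ‖h t‖ ∂haarAddCircle ≤ c := by
  refine le_of_abs_le (abs_le_of_sq_le_sq ?_ hc)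
  refine (sq_integral_mul_le (by fun_prop) (by fun_prop) (fun t => sq_nonneg _)
    (fun t => norm_nonneg _)).trans ?_
  rw [integral_norm_expSum_pow_four]
  exact (mul_le_mul_of_nonneg_left hI (Nat.cast_nonneg _)).trans hle

/-- If `A` has initial segments `B 0, …, B (J - 1)` of sizes `4 ^ s, 4 ^ (s + 1), …`, all of small
additive energy, then each of them contributes a large amount to the `L¹` norm. -/
theorem le_fourierL1Norm_of_addEnergy_le {A : Finset ℤ} {M : ℝ} (hM : 0 < M) (s J : ℕ)
    (B : ℕ → Finset ℤ) (hBA : ∀ j < J, B j ⊆ A)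
    (hlt : ∀ j < J, ∀ a ∈ A \ B j, ∀ b ∈ B j, b < a)
    (hcard : ∀ j < J, (B j).card = 4 ^ (s + j))
    (hE : ∀ j < J, 100 * M ^ 2 * ((B j).addEnergy (B j) : ℝ) ≤ ((B j).card : ℝ) ^ 3) :
    J * M / 4 ≤ fourierL1Norm A := by
  have hex : ∀ j, ∃ H h : C(UnitAddCircle, ℂ), j < J → H ∈ antiDiscAlgebra ∧ h ∈ antiDiscAlgebra ∧
      (∀ t, (M / (B j).card * ‖expSum (B j) t‖) ^ 2 ≤ (H t).re) ∧
      (∀ t, M / (B j).card * ‖expSum (B j) t‖ ≤ (h t).re) ∧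
      ∫ t, ‖H t‖ ^ 2 ∂haarAddCircle ≤ 8 * ((M / (B j).card) ^ 4 * (B j).addEnergy (B j)) ∧
      ∫ t, ‖h t‖ ^ 2 ∂haarAddCircle ≤ 8 * (M ^ 2 / (B j).card) := by
    intro j
    by_cases hj : j < J
    · have hne : (B j).Nonempty := by
        rw [← Finset.card_pos, hcard j hj]; positivity
      obtain ⟨H, h1, h, h2, h3⟩ := exists_corrections hne hM
      exact ⟨H, h, fun _ => ⟨h1, h2, h3⟩⟩
    · exact ⟨0, 0, fun h => absurd h hj⟩
  choose H h hHh using hex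
  let G : ℕ → C(UnitAddCircle, ℂ) := fun j => H j + ∑ k ∈ Finset.Ico (j + 1) J, h k
  have hG : ∀ j < J, G j ∈ antiDiscAlgebra := fun j hj =>
    add_mem (hHh j hj).1 (sum_mem fun k hk => (hHh k (Finset.mem_Ico.1 hk).2).2.1)
  have hGre : ∀ j < J, ∀ t, 0 ≤ (G j t).re := by
    intro j hj t
    simp only [G, ContinuousMap.add_apply, ContinuousMap.sum_apply, Complex.add_re, Complex.re_sum]
    refine add_nonneg ((sq_nonneg _).trans ((hHh j hj).2.2.1 t)) (Finset.sum_nonneg fun k hk => ?_)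
    exact le_trans (by positivity) ((hHh k (Finset.mem_Ico.1 hk).2).2.2.2.1 t)
  have hW : ∀ j, ∃ W : C(UnitAddCircle, ℂ), j < J → W ∈ antiDiscAlgebra ∧
      ∀ t, W t = Complex.exp (-G j t) := by
    intro j
    by_cases hj : j < J
    · obtain ⟨W, hW, hWt⟩ := exp_mem_antiDiscAlgebra (neg_mem (hG j hj))
      exact ⟨W, fun _ => ⟨hW, hWt⟩⟩
    · exact ⟨0, fun h => absurd h hj⟩
  choose W hW using hW
  let Φ : C(UnitAddCircle, ℂ) :=
    ∑ j ∈ Finset.range J, ((M / (B j).card : ℝ) : ℂ) • (expSum (B j) * W j)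
  have hΦ : ∀ t, ‖Φ t‖ ≤ 2 := by
    intro t
    have := norm_sum_mul_exp_neg_le
      (fun j => ((M / (B j).card : ℝ) : ℂ) * expSum (B j) t) (fun j => H j t) (fun j => h j t) J
      (fun j hj => by
        rw [norm_mul, Complex.norm_real, Real.norm_of_nonneg (by positivity)]
        exact (hHh j hj).2.2.1 t)
      (fun j hj => by
        rw [norm_mul, Complex.norm_real, Real.norm_of_nonneg (by positivity)]
        exact (hHh j hj).2.2.2.1 t)
    convert this using 2
    simp only [Φ, ContinuousMap.sum_apply]
    refine Finset.sum_congr rfl fun j hj => ?_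
    rw [ContinuousMap.smul_apply, ContinuousMap.mul_apply, (hW j (Finset.mem_range.1 hj)).2,
      smul_eq_mul, mul_assoc]
    simp [G]
  have hupper : (circleMean (Φ * star (expSum A))).re ≤ 2 * fourierL1Norm A := by
    refine (Complex.re_le_norm _).trans ?_
    rw [circleMean_apply, fourierL1Norm_eq_integral_norm_expSum, ← integral_const_mul]
    refine (norm_integral_le_integral_norm _).trans ?_
    refine integral_mono (integrable_of_continuous (ContinuousMap.continuous _).norm)
      (integrable_of_continuous (by fun_prop)) fun t => ?_
    show ‖Φ t * star (expSum A t)‖ ≤ _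
    rw [norm_mul, norm_star]
    exact mul_le_mul_of_nonneg_right (hΦ t) (norm_nonneg _)
  have hblock : ∀ j ∈ Finset.range J, M / 2 ≤
      (circleMean (((M / (B j).card : ℝ) : ℂ) • (expSum (B j) * W j) * star (expSum A))).re := by
    intro j hj
    have hj := Finset.mem_range.1 hj
    have hnj : ((B j).card : ℝ) = 4 ^ (s + j) := by exact_mod_cast hcard j hj
    have hnpos : (0 : ℝ) < (B j).card := by rw [hnj]; positivity
    set n : ℝ := ((B j).card : ℝ) with hn
    have hEj := hE j hj
    set E : ℝ := ((B j).addEnergy (B j) : ℝ) with hEdef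
    have hE0 : 0 ≤ E := Nat.cast_nonneg _
    have hH : ∫ t, ‖expSum (B j) t‖ ^ 2 * ‖H j t‖ ∂haarAddCircle ≤ n / 20 := by
      refine integral_sq_mul_norm_le (by positivity) (hHh j hj).2.2.2.2.1 ?_
      have h1 : (100 * M ^ 2 * E) ^ 2 ≤ (n ^ 3) ^ 2 := pow_le_pow_left₀ (by positivity) hEj 2
      rw [← hn, ← hEdef]
      have : E * (8 * ((M / n) ^ 4 * E)) = 8 * (100 * M ^ 2 * E) ^ 2 / (10 ^ 4 * n ^ 4) := by
        field_simp; norm_num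
      rw [this, div_le_iff₀ (by positivity)]
      nlinarith [h1, pow_pos hnpos 6]
    have hh : ∀ k ∈ Finset.Ico (j + 1) J,
        ∫ t, ‖expSum (B j) t‖ ^ 2 * ‖h k t‖ ∂haarAddCircle ≤ 3 / 10 * n * (1 / 2) ^ (k - j) := by
      intro k hk
      obtain ⟨hjk, hkJ⟩ := Finset.mem_Ico.1 hk
      refine integral_sq_mul_norm_le (by positivity) (hHh k hkJ).2.2.2.2.2 ?_
      have hnk : ((B k).card : ℝ) = n * 4 ^ (k - j) := by
        rw [hcard k hkJ, hnj]; push_cast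
        rw [← pow_add]; congr 1; omega
      have h4 : ((1 / 2 : ℝ) ^ (k - j)) ^ 2 = 1 / 4 ^ (k - j) := by
        rw [← pow_mul, mul_comm, pow_mul, ← one_div_pow]; norm_num
      rw [hnk, ← hEdef, mul_pow, h4]
      have h5 : (0 : ℝ) < 4 ^ (k - j) := by positivity
      have : E * (8 * (M ^ 2 / (n * 4 ^ (k - j))))
          = (100 * M ^ 2 * E) * (8 / 100) / (n * 4 ^ (k - j)) := by
        field_simp
      rw [this, div_le_iff₀ (by positivity)]
      have : (3 / 10 * n) ^ 2 * (1 / 4 ^ (k - j)) * (n * 4 ^ (k - j)) = 9 / 100 * n ^ 3 := by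
        field_simp; norm_num
      rw [this]
      nlinarith [pow_pos hnpos 3]
    -- The sizes grow by a factor `4`, so the `L²` norms of the `h k` decay like a geometric series.
    have hgeom : ∑ k ∈ Finset.Ico (j + 1) J, (1 / 2 : ℝ) ^ (k - j) ≤ 1 := by
      rw [Finset.sum_Ico_eq_sum_range]
      calc ∑ i ∈ Finset.range (J - (j + 1)), (1 / 2 : ℝ) ^ (j + 1 + i - j)
          = ∑ i ∈ Finset.range (J - (j + 1)), (1 / 2 : ℝ) / 2 ^ i * (1 / 1) := by
            refine Finset.sum_congr rfl fun i _ => ?_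
            rw [show j + 1 + i - j = i + 1 by omega, pow_succ, one_div_pow]; ring
        _ ≤ 1 := by
            have := sum_geometric_two_le (J - (j + 1))
            simp_rw [one_div_pow] at this
            rw [← Finset.sum_mul]
            simp_rw [div_eq_mul_one_div (1 / 2 : ℝ)]
            rw [← Finset.mul_sum]
            linarith
    have herr : ∫ t, ‖expSum (B j) t‖ ^ 2 * ‖G j t‖ ∂haarAddCircle ≤ n / 2 := by
      calc ∫ t, ‖expSum (B j) t‖ ^ 2 * ‖G j t‖ ∂haarAddCircle
          ≤ ∫ t, (‖expSum (B j) t‖ ^ 2 * ‖H j t‖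
              + ∑ k ∈ Finset.Ico (j + 1) J, ‖expSum (B j) t‖ ^ 2 * ‖h k t‖) ∂haarAddCircle := by
            refine integral_mono (integrable_of_continuous (by fun_prop))
              (integrable_of_continuous (by fun_prop)) fun t => ?_
            simp only [← Finset.mul_sum, ← mul_add]
            refine mul_le_mul_of_nonneg_left ?_ (sq_nonneg _)
            simp only [G, ContinuousMap.add_apply, ContinuousMap.sum_apply]
            exact (norm_add_le _ _).trans (add_le_add_right (norm_sum_le _ _) _)
        _ = ∫ t, ‖expSum (B j) t‖ ^ 2 * ‖H j t‖ ∂haarAddCircle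
              + ∑ k ∈ Finset.Ico (j + 1) J,
                ∫ t, ‖expSum (B j) t‖ ^ 2 * ‖h k t‖ ∂haarAddCircle := by
            rw [integral_add (integrable_of_continuous (by fun_prop))
              (integrable_of_continuous (by fun_prop)), integral_finsetSum]
            exact fun k _ => integrable_of_continuous (by fun_prop)
        _ ≤ n / 20 + ∑ k ∈ Finset.Ico (j + 1) J, 3 / 10 * n * (1 / 2) ^ (k - j) :=
            add_le_add hH (Finset.sum_le_sum hh)
        _ ≤ n / 2 := by
            rw [← Finset.mul_sum]
            nlinarith
    have hmain := le_re_circleMean_expSum_mul (hBA j hj) (hlt j hj) (hW j hj).1 (hW j hj).2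
      (hGre j hj)
    rw [smul_mul_assoc, map_smul, smul_eq_mul, Complex.re_ofReal_mul]
    calc M / 2 = M / n * (n / 2) := by field_simp
      _ ≤ _ := mul_le_mul_of_nonneg_left (by linarith) (by positivity)
  have hlower : J * (M / 2) ≤ (circleMean (Φ * star (expSum A))).re := by
    have := Finset.card_nsmul_le_sum _ _ _ hblock
    rw [Finset.card_range, nsmul_eq_mul] at this
    rwa [Finset.sum_mul, map_sum, Complex.re_sum]
  linarith

lemma exists_initial_segment (A : Finset ℤ) {m : ℕ} (hm : m ≤ A.card) :
    ∃ B ⊆ A, B.card = m ∧ ∀ a ∈ A \ B, ∀ b ∈ B, b < a := by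
  induction m with
  | zero => exact ⟨∅, by simp, by simp, by simp⟩
  | succ m ih =>
    obtain ⟨B, hBA, hB, hlt⟩ := ih (by omega)
    have hne : (A \ B).Nonempty := by
      rw [← Finset.card_pos, Finset.card_sdiff_of_subset hBA]; omega
    have hmin := Finset.min'_mem _ hne
    refine ⟨insert ((A \ B).min' hne) B, ?_, ?_, ?_⟩
    · exact Finset.insert_subset (Finset.mem_sdiff.1 hmin).1 hBA
    · rw [Finset.card_insert_of_notMem (Finset.mem_sdiff.1 hmin).2, hB]
    · intro a ha b hb
      simp only [Finset.mem_sdiff, Finset.mem_insert, not_or] at ha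
      have haB : a ∈ A \ B := Finset.mem_sdiff.2 ⟨ha.1, ha.2.2⟩
      rcases Finset.mem_insert.1 hb with rfl | hb
      · exact lt_of_le_of_ne (Finset.min'_le _ _ haB) (Ne.symm ha.2.1)
      · exact hlt a haB b hb

/-- A set with `L¹` norm at most `K log |A|` has a polynomially large subset of large additive
energy: otherwise each of its initial segments of size `4 ^ i`, with `i` ranging over the upper half
of the possible scales, contributes `12 K / 4` to the norm. -/
theorem exists_subset_le_addEnergy {K : ℝ} (hK : 0 < K) {A : Finset ℤ} (hA : 4 ≤ A.card)
    (hnorm : fourierL1Norm A ≤ K * Real.log A.card) :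
    ∃ B ⊆ A, B.Nonempty ∧ A.card ≤ B.card ^ 4 ∧
      1 / (14400 * K ^ 2) * (B.card : ℝ) ^ 3 ≤ B.addEnergy B := by
  by_contra! hcon
  set N := A.card with hN
  set m := Nat.log 4 N with hm
  have hm1 : 1 ≤ m := Nat.log_pos (by norm_num) hA
  have hmN : 4 ^ m ≤ N := Nat.pow_log_le_self 4 (by omega)
  have hNm : N < 4 ^ (m + 1) := Nat.lt_pow_succ_log_self (by norm_num) N
  set s := (m + 1) / 2 with hs
  set J := m + 1 - s with hJ
  have hseg : ∀ j, ∃ B : Finset ℤ, j < J → B ⊆ A ∧ B.card = 4 ^ (s + j) ∧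
      ∀ a ∈ A \ B, ∀ b ∈ B, b < a := by
    intro j
    by_cases hj : j < J
    · obtain ⟨B, h1, h2, h3⟩ := exists_initial_segment A (m := 4 ^ (s + j))
        ((Nat.pow_le_pow_right (by norm_num) (by omega)).trans hmN)
      exact ⟨B, fun _ => ⟨h1, h2, h3⟩⟩
    · exact ⟨∅, fun h => absurd h hj⟩
  choose B hB using hseg
  -- Each scale contributes `12 K / 4`, there are `J` of them, and `J ≥ log N / 2.8 > log N / 3`.
  have hlow := le_fourierL1Norm_of_addEnergy_le (A := A) (M := 12 * K) (by positivity) s J B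
    (fun j hj => (hB j hj).1) (fun j hj => (hB j hj).2.2) (fun j hj => (hB j hj).2.1)
    (fun j hj => by
      have hc := (hB j hj).2.1
      have h1 := hcon (B j) (hB j hj).1 (by rw [← Finset.card_pos, hc]; positivity) (by
        rw [hc, ← pow_mul]
        exact hNm.le.trans (Nat.pow_le_pow_right (by norm_num) (by omega)))
      rw [one_div, inv_mul_eq_div, lt_div_iff₀ (by positivity)] at h1
      nlinarith)
  have hlog : Real.log N ≤ J * 2.8 := by
    have h1 : Real.log N ≤ Real.log (4 ^ (m + 1)) :=
      Real.log_le_log (by exact_mod_cast (by omega : 0 < N)) (by exact_mod_cast hNm.le)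
    have h4 : Real.log 4 ≤ 1.4 := by
      rw [show (4 : ℝ) = 2 ^ 2 by norm_num, Real.log_pow]
      have := Real.log_two_lt_d9
      push_cast
      linarith
    have h2 : ((m + 1 : ℕ) : ℝ) ≤ 2 * J := by exact_mod_cast (by omega : m + 1 ≤ 2 * J)
    rw [Real.log_pow] at h1
    have h5 : (0 : ℝ) ≤ Real.log 4 := Real.log_nonneg (by norm_num)
    have h6 : (0 : ℝ) ≤ J := Nat.cast_nonneg _
    nlinarith
  have hJ0 : (0 : ℝ) < J := by exact_mod_cast (by omega : 0 < J)
  nlinarith [mul_le_mul_of_nonneg_left hlog hK.le, mul_pos hK hJ0]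

end

/-! ### The Balog–Szemerédi–Gowers theorem -/

section

open scoped Pointwise

/-- The elements `b` of `B` for which `b - d` lies in `B`, i.e. the representations of `d` as a
difference of two elements of `B`. -/
def diffReps (B : Finset ℤ) (d : ℤ) : Finset ℤ := B.filter fun b => b - d ∈ B

lemma mem_diffReps {B : Finset ℤ} {d b : ℤ} : b ∈ diffReps B d ↔ b ∈ B ∧ b - d ∈ B := by
  simp [diffReps]

lemma addEnergy_le_sum_card_diffReps_sq (B : Finset ℤ) :
    B.addEnergy B ≤ ∑ s ∈ B - B, (diffReps B s).card ^ 2 := by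
  have : ∑ s ∈ B - B, (diffReps B s).card ^ 2
      = ((B - B).sigma fun s => diffReps B s ×ˢ diffReps B s).card := by
    simp [Finset.card_sigma, sq]
  rw [this, Finset.addEnergy]
  refine Finset.card_le_card_of_injOn (fun x => ⟨x.1.1 - x.1.2, (x.1.1, x.2.2)⟩) ?_ ?_
  · rintro ⟨⟨a, b⟩, c, d⟩ hx
    simp only [Finset.coe_filter, Finset.mem_product, Set.mem_ofPred_eq] at hx
    obtain ⟨⟨⟨ha, hb⟩, hc, hd⟩, h⟩ := hx
    simp only [Finset.coe_sigma, Set.mem_sigma_iff, Finset.mem_coe, Finset.mem_product, mem_diffReps]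
    refine ⟨Finset.sub_mem_sub ha hb, ⟨ha, ?_⟩, hd, ?_⟩
    · rwa [show a - (a - b) = b by ring]
    · rwa [show d - (a - b) = c by linarith]
  · rintro ⟨⟨a, b⟩, c, d⟩ hx ⟨⟨a', b'⟩, c', d'⟩ hy h
    simp only [Finset.coe_filter, Finset.mem_product, Set.mem_ofPred_eq] at hx hy
    simp only [Sigma.mk.injEq, heq_eq_eq, Prod.mk.injEq] at h ⊢
    omega

lemma sum_card_diffReps_le (B : Finset ℤ) :
    ∑ s ∈ B - B, (diffReps B s).card ≤ B.card ^ 2 := by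
  rw [← Finset.card_sigma, sq, ← Finset.card_product]
  refine Finset.card_le_card_of_injOn (fun x => (x.2, x.2 - x.1)) ?_ ?_
  · rintro ⟨s, b⟩ hx
    simp only [Finset.coe_sigma, Set.mem_sigma_iff, Finset.mem_coe, mem_diffReps] at hx
    simpa using hx.2
  · rintro ⟨s, b⟩ _ ⟨s', b'⟩ _ h
    simp only [Sigma.mk.injEq, heq_eq_eq, Prod.mk.injEq] at h ⊢
    omega

/-- The elements `b` of `S` such that the difference `a - b` is unpopular in `B`, having fewer than
`τ` representations. -/
noncomputable def unpopular (B S : Finset ℤ) (τ : ℝ) (a : ℤ) : Finset ℤ :=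
  S.filter fun b => ((diffReps B (a - b)).card : ℝ) < τ

lemma mem_unpopular {B S : Finset ℤ} {τ : ℝ} {a b : ℤ} :
    b ∈ unpopular B S τ a ↔ b ∈ S ∧ ((diffReps B (a - b)).card : ℝ) < τ := by
  simp [unpopular]

/-- Summed over all `s`, the sets `diffReps B s` contain few unpopular pairs: a pair `(a, b)` lies in
at most as many of them as `a - b` has representations. -/
lemma sum_card_unpopular_le (B : Finset ℤ) {τ : ℝ} (hτ : 0 ≤ τ) :
    ((∑ s ∈ B - B, ∑ a ∈ diffReps B s, (unpopular B (diffReps B s) τ a).card : ℕ) : ℝ)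
      ≤ τ * (B.card : ℝ) ^ 2 := by
  classical
  set P := (B ×ˢ B).filter fun x : ℤ × ℤ => ((diffReps B (x.1 - x.2)).card : ℝ) < τ with hP
  have h1 : ∑ s ∈ B - B, ∑ a ∈ diffReps B s, (unpopular B (diffReps B s) τ a).card
      ≤ ∑ x ∈ P, (diffReps B (x.1 - x.2)).card := by
    simp_rw [← Finset.card_sigma]
    refine Finset.card_le_card_of_injOn (fun x => ⟨(x.2.1, x.2.2), x.2.1 - x.1⟩) ?_ ?_
    · rintro ⟨s, a, b⟩ hx
      simp only [Finset.coe_sigma, Set.mem_sigma_iff, Finset.mem_coe, mem_diffReps,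
        mem_unpopular] at hx
      obtain ⟨_, ⟨ha, has⟩, ⟨hb, hbs⟩, hlt⟩ := hx
      simp only [Finset.coe_sigma, Set.mem_sigma_iff, Finset.mem_coe, mem_diffReps, hP,
        Finset.mem_filter, Finset.mem_product]
      refine ⟨⟨⟨ha, hb⟩, hlt⟩, has, ?_⟩
      rwa [show a - s - (a - b) = b - s by ring]
    · rintro ⟨s, a, b⟩ _ ⟨s', a', b'⟩ _ h
      simp only [Sigma.mk.injEq, heq_eq_eq, Prod.mk.injEq] at h ⊢
      omega
  calc _ ≤ ((∑ x ∈ P, (diffReps B (x.1 - x.2)).card : ℕ) : ℝ) := by exact_mod_cast h1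
    _ ≤ ∑ x ∈ P, τ := by
      push_cast
      exact Finset.sum_le_sum fun x hx => (Finset.mem_filter.1 hx).2.le
    _ = P.card * τ := by rw [Finset.sum_const, nsmul_eq_mul]
    _ ≤ (B.card ^ 2 : ℕ) * τ := by
      refine mul_le_mul_of_nonneg_right ?_ hτ
      rw [sq, ← Finset.card_product]
      exact_mod_cast Finset.card_filter_le _ _
    _ = τ * (B.card : ℝ) ^ 2 := by push_cast; ring

/-- If `a` and `a'` have few unpopular partners in `S`, then `a - a'` is in many ways a difference of
differences of elements of `B`. -/
lemma le_card_quadruples {B S : Finset ℤ} {τ : ℝ} (hτ : 0 ≤ τ) {a a' : ℤ}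
    (ha : ((unpopular B S τ a).card : ℝ) ≤ S.card / 4)
    (ha' : ((unpopular B S τ a').card : ℝ) ≤ S.card / 4) :
    S.card / 2 * τ ^ 2 ≤ ((((B ×ˢ B) ×ˢ B ×ˢ B).filter
      fun q => (q.1.1 - q.1.2) - (q.2.1 - q.2.2) = a - a').card : ℝ) := by
  classical
  set T := S \ (unpopular B S τ a ∪ unpopular B S τ a') with hT
  have hTcard : (S.card : ℝ) / 2 ≤ T.card := by
    have h1 : S.card ≤ T.card + (unpopular B S τ a ∪ unpopular B S τ a').card := by
      rw [hT]
      have := Finset.le_card_sdiff (unpopular B S τ a ∪ unpopular B S τ a') S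
      omega
    have h2 := Finset.card_union_le (unpopular B S τ a) (unpopular B S τ a')
    have h3 : (S.card : ℝ) ≤ T.card + ((unpopular B S τ a).card + (unpopular B S τ a').card) := by
      exact_mod_cast h1.trans (by omega)
    linarith
  have hTpop : ∀ b ∈ T, τ ≤ (diffReps B (a - b)).card ∧ τ ≤ (diffReps B (a' - b)).card := by
    intro b hb
    simp only [hT, Finset.mem_sdiff, Finset.mem_union, mem_unpopular, not_or, not_and,
      not_lt] at hb
    exact ⟨hb.2.1 hb.1, hb.2.2 hb.1⟩
  have hle : (T.sigma fun b => diffReps B (a - b) ×ˢ diffReps B (a' - b)).card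
      ≤ (((B ×ˢ B) ×ˢ B ×ˢ B).filter
        fun q => (q.1.1 - q.1.2) - (q.2.1 - q.2.2) = a - a').card := by
    refine Finset.card_le_card_of_injOn
      (fun x => ((x.2.1, x.2.1 - (a - x.1)), x.2.2, x.2.2 - (a' - x.1))) ?_ ?_
    · rintro ⟨b, u, v⟩ hx
      simp only [Finset.coe_sigma, Set.mem_sigma_iff, Finset.mem_coe, Finset.mem_product,
        mem_diffReps] at hx
      simp only [Finset.coe_filter, Finset.mem_product, Set.mem_ofPred_eq]
      exact ⟨⟨hx.2.1, hx.2.2⟩, by ring⟩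
    · rintro ⟨b, u, v⟩ _ ⟨b', u', v'⟩ _ h
      simp only [Sigma.mk.injEq, heq_eq_eq, Prod.mk.injEq] at h ⊢
      omega
  calc S.card / 2 * τ ^ 2 ≤ T.card * τ ^ 2 := mul_le_mul_of_nonneg_right hTcard (sq_nonneg _)
    _ = ∑ b ∈ T, τ ^ 2 := by rw [Finset.sum_const, nsmul_eq_mul]
    _ ≤ ∑ b ∈ T, ((diffReps B (a - b)).card * (diffReps B (a' - b)).card : ℝ) := by
        refine Finset.sum_le_sum fun b hb => ?_
        rw [sq]
        exact mul_le_mul (hTpop b hb).1 (hTpop b hb).2 hτ (Nat.cast_nonneg _)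
    _ = ((T.sigma fun b => diffReps B (a - b) ×ˢ diffReps B (a' - b)).card : ℝ) := by
        rw [Finset.card_sigma]; push_cast [Finset.card_product]; rfl
    _ ≤ _ := by exact_mod_cast hle

/-- **Balog–Szemerédi–Gowers theorem**, in difference form: a set of integers of large additive
energy has a large subset with small difference set. The subset is found inside `B ∩ (B + s)` for a
suitable `s`. -/
theorem exists_subset_card_sub_le {ε : ℝ} (hε : 0 < ε) {B : Finset ℤ} (hB : B.Nonempty)
    (hE : ε * (B.card : ℝ) ^ 3 ≤ B.addEnergy B) :
    ∃ B' ⊆ B, B'.Nonempty ∧ ε / 8 * B.card ≤ B'.card ∧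
      ((B' - B').card : ℝ) ≤ 2 ^ 14 / ε ^ 4 * B'.card := by
  classical
  set n : ℝ := (B.card : ℝ) with hn
  have hn0 : 0 < n := by rw [hn]; exact_mod_cast hB.card_pos
  set τ : ℝ := ε / 16 * n with hτ
  have hτ0 : 0 < τ := by positivity
  -- On average over `s`, weighted by `|diffReps B s| ^ 2`, few pairs are unpopular; the sets
  -- `diffReps B s` with at most `ε n / 4` elements contribute at most `ε n ^ 3 / 4`.
  obtain ⟨s, hs, hlarge, hbad⟩ : ∃ s ∈ B - B, ε / 4 * n < (diffReps B s).card ∧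
      ((∑ a ∈ diffReps B s, (unpopular B (diffReps B s) τ a).card : ℕ) : ℝ)
        ≤ ((diffReps B s).card : ℝ) ^ 2 / 8 := by
    by_contra! hcon
    have h1 : ∀ s ∈ B - B, ((diffReps B s).card : ℝ) ^ 2
        ≤ 8 * ((∑ a ∈ diffReps B s, (unpopular B (diffReps B s) τ a).card : ℕ) : ℝ)
          + ε / 4 * n * (diffReps B s).card := by
      intro s hs
      rcases lt_or_ge (ε / 4 * n) (diffReps B s).card with h | h
      · have := hcon s hs h
        have : 0 ≤ ε / 4 * n * (diffReps B s).card := by positivity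
        linarith
      · have h0 : (0 : ℝ) ≤ (diffReps B s).card := Nat.cast_nonneg _
        have h2 : (0 : ℝ) ≤ ((∑ a ∈ diffReps B s,
          (unpopular B (diffReps B s) τ a).card : ℕ) : ℝ) := Nat.cast_nonneg _
        nlinarith
    have h2 := Finset.sum_le_sum h1
    rw [Finset.sum_add_distrib, ← Finset.mul_sum, ← Finset.mul_sum, ← Nat.cast_sum,
      ← Nat.cast_sum] at h2
    have h3 := sum_card_unpopular_le B hτ0.le
    have h4 : ((∑ s ∈ B - B, (diffReps B s).card : ℕ) : ℝ) ≤ n ^ 2 := by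
      rw [hn]; exact_mod_cast sum_card_diffReps_le B
    have h5 : (B.addEnergy B : ℝ) ≤ ∑ s ∈ B - B, ((diffReps B s).card : ℝ) ^ 2 := by
      exact_mod_cast addEnergy_le_sum_card_diffReps_sq B
    have h6 := mul_le_mul_of_nonneg_left h4 (by positivity : 0 ≤ ε / 4 * n)
    have h7 : 0 < ε * n ^ 3 := by positivity
    rw [hτ] at h3
    nlinarith
  set S := diffReps B s with hS
  set r : ℝ := (S.card : ℝ) with hr
  have hr0 : 0 < r := lt_trans (by positivity) hlarge
  set B' := S.filter fun a => ((unpopular B S τ a).card : ℝ) ≤ S.card / 4 with hB'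
  have hB'card : r / 2 ≤ B'.card := by
    have h1 : ((S.filter fun a => ¬ ((unpopular B S τ a).card : ℝ) ≤ S.card / 4).card : ℝ) * (r / 4)
        ≤ r ^ 2 / 8 := by
      refine le_trans ?_ hbad
      rw [← nsmul_eq_mul]
      push_cast
      refine (Finset.card_nsmul_le_sum _ (fun a => ((unpopular B S τ a).card : ℝ)) _
        fun a ha => (not_le.1 (Finset.mem_filter.1 ha).2).le).trans ?_
      exact Finset.sum_le_sum_of_subset_of_nonneg (Finset.filter_subset _ _)
        fun _ _ _ => Nat.cast_nonneg _
    have h2 : (B'.card : ℝ)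
        + (S.filter fun a => ¬ ((unpopular B S τ a).card : ℝ) ≤ S.card / 4).card = r := by
      rw [hr, hB']; exact_mod_cast Finset.card_filter_add_card_filter_not (s := S) _
    nlinarith
  have hB'pos : (0 : ℝ) < B'.card := lt_of_lt_of_le (by positivity) hB'card
  refine ⟨B', (Finset.filter_subset _ _).trans (Finset.filter_subset _ _),
    Finset.card_pos.1 (by exact_mod_cast hB'pos), by linarith, ?_⟩
  have hquad : ((B' - B').card : ℝ) * (r / 2 * τ ^ 2) ≤ n ^ 4 := by
    have h1 : ∀ x ∈ B' - B', r / 2 * τ ^ 2 ≤ ((((B ×ˢ B) ×ˢ B ×ˢ B).filter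
        fun q => (q.1.1 - q.1.2) - (q.2.1 - q.2.2) = x).card : ℝ) := by
      intro x hx
      obtain ⟨a, ha, a', ha', rfl⟩ := Finset.mem_sub.1 hx
      exact le_card_quadruples hτ0.le (Finset.mem_filter.1 ha).2 (Finset.mem_filter.1 ha').2
    have h2 := Finset.card_nsmul_le_sum _ _ _ h1
    rw [nsmul_eq_mul] at h2
    refine h2.trans ?_
    rw [← Nat.cast_sum, Finset.sum_card_fiberwise_eq_card_filter]
    have h3 := Finset.card_filter_le ((B ×ˢ B) ×ˢ B ×ˢ B)
      fun q => (q.1.1 - q.1.2) - (q.2.1 - q.2.2) ∈ B' - B'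
    have h4 : ((B ×ˢ B) ×ˢ B ×ˢ B).card = B.card ^ 4 := by
      simp only [Finset.card_product]; ring
    rw [h4] at h3
    rw [hn]; exact_mod_cast h3
  have h3 : r / 2 * τ ^ 2 ≥ ε ^ 3 / 2048 * n ^ 3 := by
    rw [hτ]
    have := mul_le_mul_of_nonneg_right hlarge.le (by positivity : 0 ≤ (ε / 16 * n) ^ 2 / 2)
    nlinarith
  have h4 : ((B' - B').card : ℝ) * (ε ^ 3 / 2048 * n ^ 3) ≤ n ^ 4 :=
    (mul_le_mul_of_nonneg_left h3 (Nat.cast_nonneg _)).trans hquad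
  have h5 : ((B' - B').card : ℝ) * ε ^ 3 ≤ 2048 * n := by
    have : 0 < n ^ 3 := by positivity
    refine le_of_mul_le_mul_right ?_ this
    nlinarith
  have h6 : ε * n ≤ 8 * B'.card := by linarith
  rw [div_mul_eq_mul_div, le_div_iff₀ (by positivity)]
  nlinarith [mul_le_mul_of_nonneg_left h5 hε.le]

end

/-! ### Progressions in `2S - 2S` modulo `q` -/

section

open scoped Pointwise ComplexConjugate

/-- The Fourier transform of the indicator function of a subset of `ℤ / qℤ`. -/
noncomputable def zmodFourier {q : ℕ} [NeZero q] (S : Finset (ZMod q)) (ξ : ZMod q) : ℂ :=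
  ∑ s ∈ S, ZMod.stdAddChar (ξ * s)

lemma sum_stdAddChar_mul {q : ℕ} [NeZero q] (b : ZMod q) :
    ∑ ξ : ZMod q, (ZMod.stdAddChar (ξ * b) : ℂ) = if b = 0 then (q : ℂ) else 0 := by
  rw [AddChar.sum_mulShift b (ZMod.isPrimitive_stdAddChar q)]
  simp [ZMod.card]

lemma conj_zmodFourier {q : ℕ} [NeZero q] (S : Finset (ZMod q)) (ξ : ZMod q) :
    conj (zmodFourier S ξ) = ∑ s ∈ S, ZMod.stdAddChar (ξ * -s) := by
  simp [zmodFourier, map_sum, AddChar.map_neg_eq_conj]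

/-- **Parseval's identity** for a subset of `ℤ / qℤ`. -/
lemma sum_norm_zmodFourier_sq {q : ℕ} [NeZero q] (S : Finset (ZMod q)) :
    ∑ ξ, ‖zmodFourier S ξ‖ ^ 2 = q * S.card := by
  have h : ∑ ξ, zmodFourier S ξ * conj (zmodFourier S ξ) = (q * S.card : ℂ) := by
    simp_rw [conj_zmodFourier, zmodFourier, Finset.sum_mul_sum, ← AddChar.map_add_eq_mul,
      ← mul_add]
    rw [Finset.sum_comm]
    simp_rw [Finset.sum_comm (s := Finset.univ), sum_stdAddChar_mul, ← sub_eq_add_neg, sub_eq_zero,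
      Finset.sum_ite_eq]
    rw [Finset.sum_ite_mem, Finset.inter_self, Finset.sum_const, nsmul_eq_mul, mul_comm]
  simp_rw [Complex.mul_conj, ← Complex.sq_norm] at h
  exact_mod_cast h

/-- If `x` is not of the form `a + b - c - d` with `a, b, c, d ∈ S`, the corresponding Fourier
coefficient of `|zmodFourier S| ^ 4` vanishes. -/
lemma sum_norm_zmodFourier_pow_four_mul {q : ℕ} [NeZero q] {S : Finset (ZMod q)} {x : ZMod q}
    (hx : ∀ a ∈ S, ∀ b ∈ S, ∀ c ∈ S, ∀ d ∈ S, x ≠ a + b - c - d) :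
    ∑ ξ, ‖zmodFourier S ξ‖ ^ 4 * (ZMod.stdAddChar (ξ * x) : ℂ).re = 0 := by
  have h : ∑ ξ, (zmodFourier S ξ * zmodFourier S ξ) *
      (conj (zmodFourier S ξ) * conj (zmodFourier S ξ)) * ZMod.stdAddChar (ξ * -x) = 0 := by
    have e1 : ∀ ξ, zmodFourier S ξ * zmodFourier S ξ
        = ∑ y ∈ S ×ˢ S, (ZMod.stdAddChar (ξ * (y.1 + y.2)) : ℂ) := by
      intro ξ
      rw [zmodFourier, Finset.sum_mul_sum, ← Finset.sum_product']
      simp_rw [← AddChar.map_add_eq_mul, ← mul_add]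
    have e2 : ∀ ξ, conj (zmodFourier S ξ) * conj (zmodFourier S ξ)
        = ∑ y ∈ S ×ˢ S, (ZMod.stdAddChar (ξ * (-y.1 + -y.2)) : ℂ) := by
      intro ξ
      rw [conj_zmodFourier, Finset.sum_mul_sum, ← Finset.sum_product']
      simp_rw [← AddChar.map_add_eq_mul, ← mul_add]
    simp_rw [e1, e2, Finset.sum_mul_sum, ← Finset.sum_product', ← AddChar.map_add_eq_mul, ← mul_add,
      Finset.sum_mul, ← AddChar.map_add_eq_mul, ← mul_add]
    rw [Finset.sum_comm]
    refine Finset.sum_eq_zero fun y hy => ?_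
    simp only [Finset.mem_product] at hy
    rw [sum_stdAddChar_mul, if_neg]
    intro h0
    exact hx _ hy.1.1 _ hy.1.2 _ hy.2.1 _ hy.2.2 (by linear_combination -h0)
  have h2 := congrArg Complex.re h
  rw [Complex.re_sum, Complex.zero_re] at h2
  rw [← h2]
  refine Finset.sum_congr rfl fun ξ _ => ?_
  have h3 : (zmodFourier S ξ * zmodFourier S ξ) * (conj (zmodFourier S ξ) * conj (zmodFourier S ξ))
      = ((‖zmodFourier S ξ‖ ^ 4 : ℝ) : ℂ) := by
    rw [mul_mul_mul_comm, Complex.mul_conj, ← Complex.sq_norm]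
    push_cast; ring
  rw [h3, Complex.re_ofReal_mul, mul_neg, AddChar.map_neg_eq_conj, Complex.conj_re]

/-- The frequencies at which the Fourier transform of `S` is large. -/
noncomputable def largeSpectrum {q : ℕ} [NeZero q] (S : Finset (ZMod q)) : Finset (ZMod q) :=
  Finset.univ.filter fun ξ => (S.card : ℝ) ^ 3 / (2 * q) ≤ ‖zmodFourier S ξ‖ ^ 2

lemma card_largeSpectrum_le {q : ℕ} [NeZero q] {S : Finset (ZMod q)} (hS : S.Nonempty) :
    ((largeSpectrum S).card : ℝ) ≤ 2 * (q / S.card) ^ 2 := by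
  have hn : (0 : ℝ) < S.card := by exact_mod_cast hS.card_pos
  have hq : (0 : ℝ) < q := by exact_mod_cast NeZero.pos q
  have h1 : (largeSpectrum S).card * ((S.card : ℝ) ^ 3 / (2 * q)) ≤ q * S.card := by
    rw [← sum_norm_zmodFourier_sq, ← nsmul_eq_mul]
    refine (Finset.card_nsmul_le_sum _ (fun ξ => ‖zmodFourier S ξ‖ ^ 2) _
      fun ξ hξ => (Finset.mem_filter.1 hξ).2).trans ?_
    exact Finset.sum_le_sum_of_subset_of_nonneg (Finset.subset_univ _) fun _ _ _ => sq_nonneg _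
  have h2 : (q : ℝ) * S.card = 2 * (q / S.card) ^ 2 * ((S.card : ℝ) ^ 3 / (2 * q)) := by
    field_simp
  rw [h2] at h1
  exact le_of_mul_le_mul_right h1 (by positivity)

/-- **Bogolyubov's lemma**: `2S - 2S` contains the Bohr set of the large spectrum of `S`. -/
lemma exists_eq_of_re_stdAddChar_nonneg {q : ℕ} [NeZero q] {S : Finset (ZMod q)}
    (hS : S.Nonempty) {x : ZMod q}
    (hx : ∀ ξ ∈ largeSpectrum S, 0 ≤ (ZMod.stdAddChar (ξ * x) : ℂ).re) :
    ∃ a ∈ S, ∃ b ∈ S, ∃ c ∈ S, ∃ d ∈ S, x = a + b - c - d := by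
  by_contra! hcon
  have h0 := sum_norm_zmodFourier_pow_four_mul hcon
  have hn : (0 : ℝ) < S.card := by exact_mod_cast hS.card_pos
  have hq : (0 : ℝ) < q := by exact_mod_cast NeZero.pos q
  have hnq : (S.card : ℝ) ≤ q := by
    have := S.card_le_univ
    rw [ZMod.card] at this
    exact_mod_cast this
  set θ : ℝ := (S.card : ℝ) ^ 3 / (2 * q) with hθ
  have hzero : zmodFourier S 0 = S.card := by simp [zmodFourier]
  have hle : ∀ ξ ∈ Finset.univ, (if ξ = 0 then (S.card : ℝ) ^ 4 else 0) - θ * ‖zmodFourier S ξ‖ ^ 2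
      ≤ ‖zmodFourier S ξ‖ ^ 4 * (ZMod.stdAddChar (ξ * x) : ℂ).re := by
    intro ξ _
    by_cases h : θ ≤ ‖zmodFourier S ξ‖ ^ 2
    · have hpos := hx ξ (Finset.mem_filter.2 ⟨Finset.mem_univ _, h⟩)
      have hθ0 : 0 ≤ θ * ‖zmodFourier S ξ‖ ^ 2 := by positivity
      split_ifs with h1
      · subst h1
        simp [hzero] at hθ0 ⊢
        linarith
      · have : 0 ≤ ‖zmodFourier S ξ‖ ^ 4 * (ZMod.stdAddChar (ξ * x) : ℂ).re := by positivity
        linarith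
    · have h1 : ξ ≠ 0 := by
        rintro rfl
        refine h ?_
        rw [hzero, Complex.norm_natCast, hθ, div_le_iff₀ (by positivity)]
        nlinarith [pow_pos hn 2]
      rw [if_neg h1]
      have h2 : -1 ≤ (ZMod.stdAddChar (ξ * x) : ℂ).re := by
        have := Complex.abs_re_le_norm (ZMod.stdAddChar (ξ * x) : ℂ)
        rw [AddChar.norm_apply] at this
        exact (abs_le.1 this).1
      have h3 : 0 ≤ ‖zmodFourier S ξ‖ ^ 2 := sq_nonneg _
      nlinarith [sq_nonneg (‖zmodFourier S ξ‖ ^ 2),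
        mul_nonneg h3 (sub_nonneg.2 (not_le.1 h).le)]
  have hsum := Finset.sum_le_sum hle
  rw [h0, Finset.sum_sub_distrib, ← Finset.mul_sum, sum_norm_zmodFourier_sq,
    Finset.sum_ite_eq' Finset.univ, if_pos (Finset.mem_univ _)] at hsum
  have h5 : θ * (q * S.card) = (S.card : ℝ) ^ 4 / 2 := by rw [hθ]; field_simp
  have h6 : (0 : ℝ) < (S.card : ℝ) ^ 4 := by positivity
  linarith

/-- **Dirichlet's simultaneous approximation theorem** modulo `q`: some nonzero `d` has all products
`d * ξ`, with `ξ ∈ Γ`, represented by integers smaller than `q / Q`. -/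
lemma exists_ne_zero_forall_abs_mul_lt {q : ℕ} [NeZero q] (Γ : Finset (ZMod q)) {Q : ℕ}
    (hQ : 0 < Q) (hlt : Q ^ Γ.card < q) :
    ∃ d : ZMod q, d ≠ 0 ∧ ∀ ξ ∈ Γ, ∃ m : ℤ, (m : ZMod q) = ξ * d ∧ |m| * Q < q := by
  have hq : 0 < q := NeZero.pos q
  let F : ZMod q → (Γ → Fin Q) := fun d ξ => ⟨Q * (ξ.1 * d).val / q, by
    rw [Nat.div_lt_iff_lt_mul hq]
    exact Nat.mul_lt_mul_of_pos_left (ZMod.val_lt _) hQ⟩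
  obtain ⟨d, d', hne, hF⟩ := Fintype.exists_ne_map_eq_of_card_lt F (by
    rw [Fintype.card_fun, Fintype.card_fin, Fintype.card_coe, ZMod.card]; exact hlt)
  refine ⟨d - d', sub_ne_zero.2 hne, fun ξ hξ => ⟨(ξ * d).val - (ξ * d').val, ?_, ?_⟩⟩
  · push_cast
    rw [ZMod.natCast_zmod_val, ZMod.natCast_zmod_val, mul_sub]
  · have h := congrArg Fin.val (congrFun hF ⟨ξ, hξ⟩)
    simp only [F] at h
    set u := (ξ * d).val
    set v := (ξ * d').val
    have hu := Nat.div_add_mod (Q * u) q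
    have hv := Nat.div_add_mod (Q * v) q
    have hu' := Nat.mod_lt (Q * u) hq
    have hv' := Nat.mod_lt (Q * v) hq
    rw [h] at hu
    rw [← Nat.abs_cast Q, ← abs_mul, abs_lt]
    zify at hu hv hu' hv'
    have := Int.emod_nonneg (Q * u : ℤ) (by exact_mod_cast hq.ne' : (q : ℤ) ≠ 0)
    have := Int.emod_nonneg (Q * v : ℤ) (by exact_mod_cast hq.ne' : (q : ℤ) ≠ 0)
    constructor <;> nlinarith

lemma re_stdAddChar_intCast_nonneg {q : ℕ} [NeZero q] {m : ℤ} (hm : 4 * |m| ≤ q) :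
    0 ≤ (ZMod.stdAddChar (m : ZMod q) : ℂ).re := by
  have hq : (0 : ℝ) < q := by exact_mod_cast NeZero.pos q
  have h4 : 4 * |(m : ℝ)| ≤ q := by exact_mod_cast hm
  rw [ZMod.stdAddChar_coe, show 2 * (Real.pi : ℂ) * Complex.I * m / q
    = ((2 * Real.pi * m / q : ℝ) : ℂ) * Complex.I by push_cast; ring, Complex.exp_ofReal_mul_I_re]
  have h5 : |2 * Real.pi * m / q| ≤ Real.pi / 2 := by
    rw [abs_div, abs_mul, abs_of_pos hq, abs_of_pos Real.two_pi_pos, div_le_iff₀ hq]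
    nlinarith [Real.pi_pos]
  exact Real.cos_nonneg_of_mem_Icc ⟨(abs_le.1 h5).1, (abs_le.1 h5).2⟩

/-- A dense subset `S` of `ℤ / qℤ` is such that `2S - 2S` contains a long progression through `0`. -/
lemma exists_progression_zmod {q : ℕ} [NeZero q] {S : Finset (ZMod q)} (hS : S.Nonempty) {k L : ℕ}
    (hk : 2 * ((q : ℝ) / S.card) ^ 2 ≤ k) (hL : 0 < L) (hlt : (4 * L) ^ k < q) :
    ∃ δ : ZMod q, δ ≠ 0 ∧ ∀ j ≤ L, ∃ a ∈ S, ∃ b ∈ S, ∃ c ∈ S, ∃ d ∈ S,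
      (j : ZMod q) * δ = a + b - c - d := by
  have hcard : (largeSpectrum S).card ≤ k := by exact_mod_cast (card_largeSpectrum_le hS).trans hk
  obtain ⟨δ, hδ, hΓ⟩ := exists_ne_zero_forall_abs_mul_lt (largeSpectrum S) (Q := 4 * L) (by omega)
    ((Nat.pow_le_pow_right (by omega) hcard).trans_lt hlt)
  refine ⟨δ, hδ, fun j hj => exists_eq_of_re_stdAddChar_nonneg hS fun ξ hξ => ?_⟩
  obtain ⟨m, hm, hmq⟩ := hΓ ξ hξ
  rw [show ξ * (j * δ) = ((j * m : ℤ) : ZMod q) by push_cast; rw [hm]; ring]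
  refine re_stdAddChar_intCast_nonneg ?_
  rw [abs_mul, Nat.abs_cast]
  have : (j : ℤ) ≤ L := by exact_mod_cast hj
  push_cast at hmq
  nlinarith [abs_nonneg m]

end

/-! ### Ruzsa's modelling lemma and progressions in `2B - 2B` -/

section

open scoped Pointwise

/-- Among the dilates `u ↦ (u x) mod p`, with `x` in a set `X` of integers not divisible by
`p`, some `u` makes none of the residues divisible by `q`, provided `q` exceeds the size of
`X`. -/
lemma exists_dilate_not_dvd {p q : ℕ} (hp : p.Prime) {X : Finset ℤ} (hq : X.card < q)
    (hX : ∀ x ∈ X, ¬ (p : ℤ) ∣ x) :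
    ∃ u : ℤ, ∀ x ∈ X, ¬ (q : ℤ) ∣ (u * x) % p := by
  classical
  have hp0 : (0 : ℤ) < p := by exact_mod_cast hp.pos
  let bad : ℤ → Finset ℕ := fun x =>
    (Finset.Ioc 0 (p - 1)).filter fun u => (q : ℤ) ∣ ((u : ℤ) * x) % p
  have hbad : ∀ x ∈ X, (bad x).card ≤ (p - 1) / q := by
    intro x hx
    rw [← Nat.Ioc_filter_dvd_card_eq_div]
    refine Finset.card_le_card_of_injOn (fun u : ℕ => (((u : ℤ) * x) % p).toNat) ?_ ?_
    · intro u hu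
      simp only [bad, Finset.coe_filter, Finset.mem_Ioc, Set.mem_ofPred_eq] at hu ⊢
      have h1 := Int.emod_nonneg ((u : ℤ) * x) hp0.ne'
      have h2 := Int.emod_lt_of_pos ((u : ℤ) * x) hp0
      have h3 : ((u : ℤ) * x) % p ≠ 0 := by
        intro h
        rcases Int.Prime.dvd_mul' hp (Int.dvd_of_emod_eq_zero h) with h | h
        · have := Nat.le_of_dvd hu.1.1 (by exact_mod_cast h)
          have := hp.pos
          omega
        · exact hX x hx h
      refine ⟨by omega, ?_⟩
      have := hu.2
      rw [← Int.toNat_of_nonneg h1] at this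
      exact_mod_cast this
    · intro u hu v hv huv
      simp only [bad, Finset.coe_filter, Finset.mem_Ioc, Set.mem_ofPred_eq] at hu hv huv
      have h1 := Int.emod_nonneg ((u : ℤ) * x) hp0.ne'
      have h2 := Int.emod_nonneg ((v : ℤ) * x) hp0.ne'
      have h3 : ((u : ℤ) * x) % p = ((v : ℤ) * x) % p := by omega
      have h4 : (p : ℤ) ∣ ((u : ℤ) - v) * x := by
        rw [sub_mul]; exact Int.ModEq.dvd h3.symm
      rcases Int.Prime.dvd_mul' hp h4 with h | h
      · have := Int.eq_zero_of_abs_lt_dvd h (by have := hp.pos; rw [abs_lt]; omega)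
        omega
      · exact absurd h (hX x hx)
  obtain ⟨u, hu, hu'⟩ : ∃ u ∈ Finset.Ioc 0 (p - 1), u ∉ X.biUnion bad := by
    by_contra! hcon
    have h1 := (Finset.card_le_card hcon).trans (Finset.card_biUnion_le_card_mul X bad _ hbad)
    rw [Nat.card_Ioc] at h1
    have h2 := Nat.mul_div_le (p - 1) q
    have h3 := hp.two_le
    rcases Nat.eq_zero_or_pos ((p - 1) / q) with h | h
    · rw [h] at h1; omega
    · have := Nat.mul_lt_mul_of_pos_right hq h
      omega
  refine ⟨u, fun x hx hdvd => hu' (Finset.mem_biUnion.2 ⟨x, hx, ?_⟩)⟩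
  exact Finset.mem_filter.2 ⟨hu, hdvd⟩

/-- The graph of `w` over `B`, in `ℤ × ℤ`. Relations between elements of `B` and the corresponding
relations between their images are read off from its sumsets. -/
def graphOn (w : ℤ → ℤ) (B : Finset ℤ) : Finset (ℤ × ℤ) := B.image fun b => (b, w b)

/-- If `w` is multiplication by `u` modulo `p` and takes values in a sixth of `[0, p)`, elements of the
sumsets of its graph obey the same congruence, with second coordinate in a short interval. -/
lemma nsmul_graphOn_bounds {w : ℤ → ℤ} {B : Finset ℤ} {p : ℕ} {u i : ℤ}
    (hw : ∀ b ∈ B, (p : ℤ) ∣ w b - u * b)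
    (hi : ∀ b ∈ B, i * p ≤ 6 * w b ∧ 6 * w b ≤ (i + 1) * p - 1) (n : ℕ) :
    ∀ z ∈ n • graphOn w B, z.1 ∈ n • B ∧ (p : ℤ) ∣ z.2 - u * z.1 ∧
      n * (i * p) ≤ 6 * z.2 ∧ 6 * z.2 ≤ n * ((i + 1) * p - 1) := by
  induction n with
  | zero =>
    intro z hz
    simp only [zero_nsmul, Finset.mem_zero] at hz
    subst hz
    simp
  | succ n ih =>
    intro z hz
    rw [succ_nsmul] at hz
    obtain ⟨y, hy, g, hg, rfl⟩ := Finset.mem_add.1 hz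
    obtain ⟨b, hb, rfl⟩ := Finset.mem_image.1 hg
    obtain ⟨h1, h2, h3, h4⟩ := ih y hy
    obtain ⟨h5, h6⟩ := hi b hb
    refine ⟨?_, ?_, ?_, ?_⟩
    · rw [succ_nsmul]; exact Finset.add_mem_add h1 hb
    · rw [show (y + (b, w b)).2 - u * (y + (b, w b)).1 = (y.2 - u * y.1) + (w b - u * b) by
        simp only [Prod.fst_add, Prod.snd_add]; ring]
      exact dvd_add h2 (hw b hb)
    · push_cast; simp only [Prod.snd_add]; linarith
    · push_cast; simp only [Prod.snd_add]; linarith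

/-- **Ruzsa's modelling lemma.** A sixth of `B` is mapped by some `w` in such a way that additive
relations with six terms on either side are the same in the integers as modulo
`q = |6B - 6B|` after applying `w`. -/
lemma exists_freiman_model {B : Finset ℤ} (hB : B.Nonempty) :
    ∃ (B' : Finset ℤ) (w : ℤ → ℤ), B' ⊆ B ∧ B.card ≤ 6 * B'.card ∧
      ∀ z ∈ 6 • graphOn w B' - 6 • graphOn w B',
        (((6 • B - 6 • B).card : ℤ) ∣ z.2 → z.1 = 0) ∧ (z.1 = 0 → z.2 = 0) := by
  classical
  set X := 6 • B - 6 • B with hX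
  have h6 : (6 • B).Nonempty := hB.nsmul
  have h0 : (0 : ℤ) ∈ X := by
    obtain ⟨y, hy⟩ := h6
    rw [hX, ← sub_self y]; exact Finset.sub_mem_sub hy hy
  obtain ⟨p, hpX, hp⟩ := Nat.exists_infinite_primes (X.sup Int.natAbs + 1)
  have hp0 : (0 : ℤ) < p := by exact_mod_cast hp.pos
  obtain ⟨u, hu⟩ := exists_dilate_not_dvd hp (X := X.erase 0) (q := X.card)
    (Finset.card_erase_lt_of_mem h0) (by
      intro x hx hdvd
      obtain ⟨hx0, hx⟩ := Finset.mem_erase.1 hx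
      have h1 : x.natAbs ≤ X.sup Int.natAbs := Finset.le_sup (f := Int.natAbs) hx
      exact hx0 (Int.eq_zero_of_abs_lt_dvd hdvd (by rw [Int.abs_eq_natAbs]; omega)))
  let w : ℤ → ℤ := fun b => (u * b) % p
  have hw0 : ∀ b, 0 ≤ w b := fun b => Int.emod_nonneg _ hp0.ne'
  have hwp : ∀ b, w b < p := fun b => Int.emod_lt_of_pos _ hp0
  -- Keep the most popular of the six subintervals of `[0, p)` of length `p / 6`.
  obtain ⟨i, hi, hcard⟩ := Finset.exists_le_card_fiber_of_nsmul_le_card_of_maps_to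
    (s := B) (t := Finset.Ico (0 : ℤ) 6) (f := fun b => 6 * w b / p) (b := (B.card : ℚ) / 6)
    (fun b _ => by
      rw [Finset.mem_Ico]
      exact ⟨Int.ediv_nonneg (by linarith [hw0 b]) hp0.le,
        Int.ediv_lt_of_lt_mul hp0 (by linarith [hwp b])⟩)
    ⟨0, by simp⟩ (by simp; linarith)
  refine ⟨B.filter fun b => 6 * w b / p = i, w, Finset.filter_subset _ _, ?_, ?_⟩
  · have : (B.card : ℚ) ≤ 6 * (B.filter fun b => 6 * w b / p = i).card := by linarith
    exact_mod_cast this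
  set B' := B.filter fun b => 6 * w b / p = i with hB'
  have hbounds := nsmul_graphOn_bounds (w := w) (B := B') (p := p) (u := u) (i := i)
    (fun b _ => by
      have := Int.emod_add_mul_ediv (u * b) p
      exact ⟨-(u * b / p), by simp only [w]; linarith⟩)
    (fun b hb => by
      have h1 := (Finset.mem_filter.1 hb).2
      have h2 := Int.emod_add_mul_ediv (6 * w b) p
      have h3 := Int.emod_nonneg (6 * w b) hp0.ne'
      have h4 := Int.emod_lt_of_pos (6 * w b) hp0
      rw [h1] at h2
      constructor <;> nlinarith) 6
  have hkey : ∀ z ∈ 6 • graphOn w B' - 6 • graphOn w B',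
      z.1 ∈ X ∧ (p : ℤ) ∣ z.2 - u * z.1 ∧ |z.2| < p := by
    intro z hz
    obtain ⟨y, hy, y', hy', rfl⟩ := Finset.mem_sub.1 hz
    obtain ⟨h1, h2, h3, h4⟩ := hbounds y hy
    obtain ⟨h1', h2', h3', h4'⟩ := hbounds y' hy'
    have hsub : 6 • B' ⊆ 6 • B := Finset.nsmul_subset_nsmul_left (Finset.filter_subset _ _)
    refine ⟨Finset.sub_mem_sub (hsub h1) (hsub h1'), ?_, ?_⟩
    · rw [show (y - y').2 - u * (y - y').1 = (y.2 - u * y.1) - (y'.2 - u * y'.1) by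
        simp only [Prod.fst_sub, Prod.snd_sub]; ring]
      exact dvd_sub h2 h2'
    · push_cast at *
      rw [Prod.snd_sub, abs_lt]
      constructor <;> linarith
  have hnonneg : ∀ z ∈ 6 • graphOn w B' - 6 • graphOn w B', 0 ≤ z.2 → (X.card : ℤ) ∣ z.2 →
      z.1 = 0 := by
    intro z hz hz0 hdvd
    obtain ⟨h1, h2, h3⟩ := hkey z hz
    by_contra hne
    refine hu z.1 (Finset.mem_erase.2 ⟨hne, h1⟩) ?_
    rwa [← (Int.emod_emod_of_dvd _ dvd_rfl).symm.trans
      ((Int.emod_emod_of_dvd _ dvd_rfl).trans (Int.emod_eq_emod_iff_emod_sub_eq_zero.2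
        (Int.emod_eq_zero_of_dvd h2))), Int.emod_eq_of_lt hz0 (abs_lt.1 h3).2]
  intro z hz
  refine ⟨fun hdvd => ?_, fun h => ?_⟩
  · rcases le_total 0 z.2 with h | h
    · exact hnonneg z hz h hdvd
    · have hz' : -z ∈ 6 • graphOn w B' - 6 • graphOn w B' := by
        obtain ⟨y, hy, y', hy', rfl⟩ := Finset.mem_sub.1 hz
        rw [neg_sub]; exact Finset.sub_mem_sub hy' hy
      have := hnonneg (-z) hz' (by simpa using h) (by simpa using hdvd)
      simpa using this
  · obtain ⟨_, h2, h3⟩ := hkey z hz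
    rw [h, mul_zero, sub_zero] at h2
    exact Int.eq_zero_of_abs_lt_dvd h2 h3

/-- A set of integers with small `6B - 6B` is such that `2B - 2B` contains a long progression
through `0`. -/
lemma exists_progression_subset {B : Finset ℤ} (hB : B.Nonempty) {k L : ℕ}
    (hk : 2 * (6 * (((6 • B - 6 • B).card : ℝ) / B.card)) ^ 2 ≤ k) (hL : 0 < L)
    (hlt : (4 * L) ^ k < B.card) :
    ∃ t : ℤ, t ≠ 0 ∧ ∀ j ≤ L, (j : ℤ) * t ∈ 2 • B - 2 • B := by
  classical
  obtain ⟨B', w, hB'B, hcard, hmodel⟩ := exists_freiman_model hB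
  set q := (6 • B - 6 • B).card with hq
  set Γ := graphOn w B' with hΓ
  have hn : 0 < B.card := hB.card_pos
  have hB'card : 0 < B'.card := by omega
  have hBq : B.card ≤ q := by
    have h5 : (6 • B).Nonempty := hB.nsmul
    calc B.card ≤ (6 • B).card := by
          rw [show 6 • B = 5 • B + B from succ_nsmul B 5]
          exact Finset.card_le_card_add_left (hB.nsmul)
      _ ≤ q := Finset.card_le_card_sub_right h5
  have : NeZero q := ⟨by omega⟩
  -- Three elements of `2Γ - 2Γ` combine to an element of `6Γ - 6Γ`, where the model is faithful.
  have hsix : ∀ z₁ ∈ 2 • Γ - 2 • Γ, ∀ z₂ ∈ 2 • Γ - 2 • Γ, ∀ z₃ ∈ 2 • Γ - 2 • Γ,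
      z₁ - z₂ - z₃ ∈ 6 • Γ - 6 • Γ := by
    intro z₁ h₁ z₂ h₂ z₃ h₃
    obtain ⟨x₁, hx₁, y₁, hy₁, rfl⟩ := Finset.mem_sub.1 h₁
    obtain ⟨x₂, hx₂, y₂, hy₂, rfl⟩ := Finset.mem_sub.1 h₂
    obtain ⟨x₃, hx₃, y₃, hy₃, rfl⟩ := Finset.mem_sub.1 h₃
    rw [show 6 • Γ = 2 • Γ + 2 • Γ + 2 • Γ by rw [← add_nsmul, ← add_nsmul]]
    rw [show x₁ - y₁ - (x₂ - y₂) - (x₃ - y₃) = (x₁ + y₂ + y₃) - (y₁ + x₂ + x₃) by abel]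
    exact Finset.sub_mem_sub (Finset.add_mem_add (Finset.add_mem_add hx₁ hy₂) hy₃)
      (Finset.add_mem_add (Finset.add_mem_add hy₁ hx₂) hx₃)
  have hmem : ∀ a ∈ B', ∀ b ∈ B', ∀ c ∈ B', ∀ d ∈ B',
      (a + b - (c + d), w a + w b - (w c + w d)) ∈ 2 • Γ - 2 • Γ := by
    have hg : ∀ b ∈ B', (b, w b) ∈ Γ := fun b hb => Finset.mem_image_of_mem _ hb
    intro a ha b hb c hc d hd
    rw [two_nsmul]
    exact Finset.sub_mem_sub (Finset.add_mem_add (hg a ha) (hg b hb))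
      (Finset.add_mem_add (hg c hc) (hg d hd))
  set S : Finset (ZMod q) := B'.image fun b => (w b : ZMod q) with hS
  have hinj : Set.InjOn (fun b => (w b : ZMod q)) B' := by
    intro a ha b hb hab
    have hz := hsix _ (hmem a ha a ha b hb a ha) _ (hmem a ha a ha a ha a ha) _
      (hmem a ha a ha a ha a ha)
    have := (hmodel _ hz).1 (by
      rw [← ZMod.intCast_zmod_eq_zero_iff_dvd] 
      simp only [Prod.mk_sub_mk]
      push_cast
      simp only [] at hab
      rw [hab]; ring)
    simp only [Prod.mk_sub_mk] at this
    linarith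
  have hScard : S.card = B'.card := Finset.card_image_of_injOn hinj
  have hSne : S.Nonempty := by rw [← Finset.card_pos, hScard]; exact hB'card
  obtain ⟨δ, hδ, hprog⟩ := exists_progression_zmod hSne (k := k) (L := L) (by
    refine le_trans ?_ hk
    have h1 : (B.card : ℝ) ≤ 6 * B'.card := by exact_mod_cast hcard
    have h2 : (0 : ℝ) < B.card := by exact_mod_cast hn
    have h3 : (0 : ℝ) < B'.card := by exact_mod_cast hB'card
    rw [hScard]
    gcongr
    rw [← mul_div_assoc, div_le_div_iff₀ h3 h2]
    nlinarith [(Nat.cast_nonneg q : (0 : ℝ) ≤ q)]) hL (hlt.trans_le hBq)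
  have hlift : ∀ j, ∃ v : ℤ × ℤ, j ≤ L → v ∈ 2 • Γ - 2 • Γ ∧ (v.2 : ZMod q) = j * δ ∧
      v.1 ∈ 2 • B - 2 • B := by
    intro j
    by_cases hj : j ≤ L
    · obtain ⟨a, ha, b, hb, c, hc, d, hd, h⟩ := hprog j hj
      obtain ⟨a', ha', rfl⟩ := Finset.mem_image.1 ha
      obtain ⟨b', hb', rfl⟩ := Finset.mem_image.1 hb
      obtain ⟨c', hc', rfl⟩ := Finset.mem_image.1 hc
      obtain ⟨d', hd', rfl⟩ := Finset.mem_image.1 hd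
      refine ⟨_, fun _ => ⟨hmem a' ha' b' hb' c' hc' d' hd', ?_, ?_⟩⟩
      · rw [h]; push_cast; ring
      · rw [two_nsmul]
        exact Finset.sub_mem_sub (Finset.add_mem_add (hB'B ha') (hB'B hb'))
          (Finset.add_mem_add (hB'B hc') (hB'B hd'))
    · exact ⟨0, fun h => absurd h hj⟩
  choose v hv using hlift
  have hv0 : (v 0).1 = 0 := by
    have h := hv 0 (Nat.zero_le _)
    have := (hmodel _ (hsix _ h.1 _ h.1 _ h.1)).1 (by
      rw [← ZMod.intCast_zmod_eq_zero_iff_dvd]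
      simp [h.2.1])
    simpa using this
  -- Consecutive lifts differ by the first one, since this holds modulo `q`.
  have hvj : ∀ j ≤ L, (v j).1 = j * (v 1).1 := by
    intro j
    induction j with
    | zero => intro _; simpa using hv0
    | succ j ih =>
      intro hj
      have h := hv (j + 1) hj
      have h' := hv j (by omega)
      have h1 := hv 1 (by omega)
      have := (hmodel _ (hsix _ h.1 _ h'.1 _ h1.1)).1 (by
        rw [← ZMod.intCast_zmod_eq_zero_iff_dvd]
        simp only [Prod.snd_sub]
        push_cast
        rw [h.2.1, h'.2.1, h1.2.1]
        push_cast; ring)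
      simp only [Prod.fst_sub] at this
      rw [ih (by omega)] at this
      push_cast
      linarith
  refine ⟨(v 1).1, fun h => hδ ?_, fun j hj => ?_⟩
  · have h1 := hv 1 hL
    have h0 := hv 0 (Nat.zero_le _)
    have := (hmodel _ (hsix _ h1.1 _ h0.1 _ h0.1)).2 (by simp [h, hv0])
    have h2 := congrArg (Int.cast : ℤ → ZMod q) this
    simp only [Prod.snd_sub] at h2
    push_cast at h2
    rw [h1.2.1, h0.2.1] at h2
    simpa using h2
  · rw [← hvj j hj]; exact (hv j hj).2.2

end

/-! ### Density on a progression -/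

section

open scoped Pointwise

lemma isArithmeticProgression_image {t : ℤ} (ht : t ≠ 0) (x : ℤ) (L : ℕ) :
    IsArithmeticProgression ((Finset.range L).image fun j : ℕ => x - j * t) L := by
  rcases lt_or_gt_of_ne ht with h | h
  · exact ⟨x, -t, by omega, Finset.image_congr fun j _ => by simp [sub_eq_add_neg]⟩
  · -- For positive `t` the terms are listed in decreasing order, so they are enumerated backwards.
    refine ⟨x - (L - 1) * t, t, h, ?_⟩
    ext y
    simp only [Finset.mem_image, Finset.mem_range]
    constructor
    · rintro ⟨j, hj, rfl⟩
      refine ⟨L - 1 - j, by omega, ?_⟩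
      rw [Nat.cast_sub (by omega), Nat.cast_sub (by omega)]
      push_cast; ring
    · rintro ⟨j, hj, rfl⟩
      refine ⟨L - 1 - j, by omega, ?_⟩
      rw [Nat.cast_sub (by omega), Nat.cast_sub (by omega)]
      push_cast; ring

/-- If the progression `0, t, …, L t` lies in `2B - 2B` and `3B - 2B` is small, then `B` is dense on
a translate of the reversed progression: the sums `b + j t` all lie in the small set `3B - 2B`. -/
lemma exists_translate_dense {B : Finset ℤ} (hB : B.Nonempty) {C : ℝ} (hC : 0 < C)
    (hcard : ((3 • B - 2 • B).card : ℝ) ≤ C * B.card) {t : ℤ} (ht0 : t ≠ 0) {L : ℕ}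
    (ht : ∀ j ≤ L, (j : ℤ) * t ∈ 2 • B - 2 • B) :
    ∃ x : ℤ, 1 / C * ((L + 1 : ℕ) : ℝ)
      ≤ ((B ∩ (Finset.range (L + 1)).image fun j : ℕ => x - j * t).card : ℝ) := by
  classical
  have hmaps : ∀ y ∈ B ×ˢ Finset.range (L + 1), y.1 + (y.2 : ℤ) * t ∈ 3 • B - 2 • B := by
    intro y hy
    obtain ⟨h1, h2⟩ := Finset.mem_product.1 hy
    obtain ⟨u, hu, v, hv, huv⟩ :=
      Finset.mem_sub.1 (ht y.2 (by have := Finset.mem_range.1 h2; omega))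
    rw [← huv, show y.1 + (u - v) = (u + y.1) - v by ring, show 3 • B = 2 • B + B from succ_nsmul B 2]
    exact Finset.sub_mem_sub (Finset.add_mem_add hu h1) hv
  have hne : (3 • B - 2 • B).Nonempty := (hB.nsmul).sub hB.nsmul
  obtain ⟨x, _, hx⟩ := Finset.exists_le_card_fiber_of_nsmul_le_card_of_maps_to hmaps hne
    (b := 1 / C * ((L + 1 : ℕ) : ℝ)) (by
      rw [nsmul_eq_mul, Finset.card_product, Finset.card_range, Nat.cast_mul, ← mul_assoc]
      refine mul_le_mul_of_nonneg_right ?_ (Nat.cast_nonneg _)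
      rw [mul_one_div, div_le_iff₀ hC]
      linarith)
  refine ⟨x, hx.trans ?_⟩
  norm_cast
  refine Finset.card_le_card_of_injOn Prod.fst ?_ ?_
  · rintro ⟨b, j⟩ hy
    simp only [Finset.coe_filter, Finset.mem_product, Set.mem_ofPred_eq] at hy
    rw [Finset.mem_coe, Finset.mem_inter, Finset.mem_image]
    exact ⟨hy.1.1, j, hy.1.2, by linarith⟩
  · rintro ⟨b, j⟩ hy ⟨b', j'⟩ hy' h
    simp only [Finset.coe_filter, Finset.mem_product, Set.mem_ofPred_eq] at hy hy' h
    subst h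
    have : (j : ℤ) = j' := mul_right_cancel₀ ht0 (by linarith [hy.2, hy'.2])
    rw [Prod.mk.injEq]
    exact ⟨rfl, by exact_mod_cast this⟩

/-- A set of integers of large additive energy is dense on a long arithmetic progression. -/
theorem exists_progression_of_addEnergy {ε : ℝ} (hε : 0 < ε) :
    ∃ c : ℝ, 0 < c ∧ ∀ B : Finset ℤ, B.Nonempty → ε * (B.card : ℝ) ^ 3 ≤ B.addEnergy B →
      ∃ (L : ℕ) (P : Finset ℤ), IsArithmeticProgression P L ∧
        (B.card : ℝ) ^ c ≤ L ∧ c * P.card ≤ (B ∩ P).card := by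
  classical
  -- `C` bounds the doubling of the subset with small difference set, and `k` the number of
  -- frequencies in the large spectrum of its model.
  obtain ⟨C, hC⟩ : ∃ C : ℝ, C = 2 ^ 14 / ε ^ 4 := ⟨_, rfl⟩
  have hC0 : 0 < C := by rw [hC]; positivity
  obtain ⟨k, hk⟩ := exists_nat_ge (2 * (6 * C ^ 12) ^ 2)
  set D : ℝ := 8 / ε * 4 ^ (k + 1) + 2 with hD
  have hD2 : 2 ≤ D := by
    have : 0 ≤ 8 / ε * (4 : ℝ) ^ (k + 1) := by positivity
    linarith
  have hDlog : 0 < Real.log D := Real.log_pos (by linarith)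
  set c : ℝ := min (min (1 / (2 * (k + 1 : ℕ))) (Real.log 2 / (2 * Real.log D)))
    (min (1 / C ^ 5) (1 / 2)) with hc
  have hc0 : 0 < c := by
    refine lt_min (lt_min (by positivity) ?_) (lt_min (by positivity) (by norm_num))
    exact div_pos (Real.log_pos (by norm_num)) (by positivity)
  have hc1 : c ≤ 1 / (2 * (k + 1 : ℕ)) := (min_le_left _ _).trans (min_le_left _ _)
  have hc2 : c ≤ Real.log 2 / (2 * Real.log D) := (min_le_left _ _).trans (min_le_right _ _)
  have hc3 : c ≤ 1 / C ^ 5 := (min_le_right _ _).trans (min_le_left _ _)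
  have hc4 : c ≤ 1 / 2 := (min_le_right _ _).trans (min_le_right _ _)
  refine ⟨c, hc0, fun B hB hE => ?_⟩
  have hn1 : (1 : ℝ) ≤ B.card := by exact_mod_cast hB.card_pos
  rcases lt_or_ge (B.card : ℝ) (D ^ 2) with hsmall | hbig
  · -- For bounded `|B|` a progression with two terms, one of them in `B`, is long enough.
    obtain ⟨b, hb⟩ := hB
    refine ⟨2, _, ⟨b, 1, one_pos, rfl⟩, ?_, ?_⟩
    · calc (B.card : ℝ) ^ c ≤ (D ^ 2) ^ c :=
            Real.rpow_le_rpow (by linarith) hsmall.le hc0.le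
        _ = Real.exp (Real.log (D ^ 2) * c) := Real.rpow_def_of_pos (by positivity) _
        _ ≤ Real.exp (Real.log 2) := by
            rw [Real.exp_le_exp, Real.log_pow]
            rw [le_div_iff₀ (by positivity)] at hc2
            push_cast; linarith
        _ = (2 : ℕ) := by rw [Real.exp_log (by norm_num)]; norm_num
    · have h1 : ((Finset.range 2).image fun i : ℕ => b + (i : ℤ) * 1).card ≤ 2 :=
        Finset.card_image_le
      have h2 : 1 ≤ (B ∩ (Finset.range 2).image fun i : ℕ => b + (i : ℤ) * 1).card :=
        Finset.card_pos.2 ⟨b, Finset.mem_inter.2 ⟨hb, Finset.mem_image.2 ⟨0, by simp⟩⟩⟩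
      have h1' : (((Finset.range 2).image fun i : ℕ => b + (i : ℤ) * 1).card : ℝ) ≤ 2 := by
        exact_mod_cast h1
      have h2' : (1 : ℝ) ≤ (B ∩ (Finset.range 2).image fun i : ℕ => b + (i : ℤ) * 1).card := by
        exact_mod_cast h2
      calc _ ≤ (1 / 2 : ℝ) * 2 := mul_le_mul hc4 h1' (Nat.cast_nonneg _) (by norm_num)
        _ ≤ _ := by linarith
  · obtain ⟨B', hB'B, hB', hlarge, hdiff⟩ := exists_subset_card_sub_le hε hB hE
    rw [← hC] at hdiff
    have hn' : (0 : ℝ) < B'.card := by exact_mod_cast hB'.card_pos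
    have hplu : ∀ m l : ℕ, ((m • B' - l • B').card : ℝ) ≤ C ^ (m + l) * B'.card := by
      intro m l
      have h1 := Finset.pluennecke_ruzsa_inequality_nsmul_sub_nsmul_sub hB' B' m l
      have h2 : ((m • B' - l • B').card : ℝ)
          ≤ ((B' - B').card / B'.card : ℝ) ^ (m + l) * B'.card := by
        have := (NNRat.cast_le (K := ℝ)).2 h1
        push_cast at this
        exact this
      refine h2.trans (mul_le_mul_of_nonneg_right ?_ hn'.le)
      exact pow_le_pow_left₀ (by positivity) ((div_le_iff₀ hn').2 hdiff) _
    have hsix : ((6 • B' - 6 • B').card : ℝ) ≤ C ^ 12 * B'.card := hplu 6 6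
    have hfive : ((3 • B' - 2 • B').card : ℝ) ≤ C ^ 5 * B'.card := hplu 3 2
    -- Since `y ^ (k + 1) = |B'|`, a progression with about `y / 4` steps is admissible.
    set y : ℝ := (B'.card : ℝ) ^ (1 / (k + 1 : ℕ) : ℝ) with hy
    have hy0 : 0 < y := Real.rpow_pos_of_pos hn' _
    have hypow : y ^ (k + 1) = B'.card := by
      rw [hy, one_div]; exact Real.rpow_inv_natCast_pow hn'.le (by omega)
    have hquot : (B.card : ℝ) / D ≤ B'.card / 4 ^ (k + 1) := by
      rw [div_le_div_iff₀ (by linarith) (by positivity)]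
      have h1 : (B.card : ℝ) ≤ 8 / ε * B'.card := by
        rw [div_mul_eq_mul_div, le_div_iff₀ hε]; linarith
      have h2 : (8 / ε * B'.card) * (4 : ℝ) ^ (k + 1) ≤ B'.card * D := by
        rw [hD]; nlinarith
      exact (mul_le_mul_of_nonneg_right h1 (by positivity)).trans h2
    have hroot : (B.card : ℝ) ^ c ≤ y / 4 := by
      have hsq : (B.card : ℝ) ≤ ((B.card : ℝ) / D) ^ 2 := by
        rw [div_pow, le_div_iff₀ (by positivity)]
        nlinarith
      refine (Real.rpow_le_rpow_of_exponent_le hn1 hc1).trans ?_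
      refine le_of_pow_le_pow_left₀ (n := 2 * (k + 1)) (by omega) (by positivity) ?_
      rw [← Real.rpow_natCast, ← Real.rpow_mul (by linarith)]
      rw [show (1 / (2 * (k + 1 : ℕ)) * ((2 * (k + 1) : ℕ) : ℝ) : ℝ) = 1 by
        push_cast; field_simp, Real.rpow_one]
      refine hsq.trans ?_
      rw [mul_comm 2, pow_mul, div_pow y, hypow]
      exact pow_le_pow_left₀ (by positivity) hquot 2
    have hy4 : 4 ≤ y := by
      refine le_of_pow_le_pow_left₀ (n := k + 1) (by omega) hy0.le ?_
      rw [hypow]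
      have h1 : 1 ≤ (B.card : ℝ) / D := by
        rw [le_div_iff₀ (by linarith)]; nlinarith
      have h2 := h1.trans hquot
      rwa [le_div_iff₀ (by positivity), one_mul] at h2
    set L := ⌊y / 4⌋₊ with hL
    have hL0 : 0 < L := Nat.floor_pos.2 (by linarith)
    have hLy : 4 * (L : ℝ) ≤ y := by linarith [Nat.floor_le (by positivity : 0 ≤ y / 4)]
    have hlt : (4 * L) ^ k < B'.card := by
      have : (4 * (L : ℝ)) ^ k < B'.card := by
        rw [← hypow, pow_succ]
        have h1 : 0 < y ^ k := by positivity
        have h2 := pow_le_pow_left₀ (by positivity) hLy k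
        nlinarith
      exact_mod_cast this
    have hratio : 2 * (6 * (((6 • B' - 6 • B').card : ℝ) / B'.card)) ^ 2 ≤ k := by
      have h1 := (div_le_iff₀ hn').2 hsix
      have h2 := div_nonneg (Nat.cast_nonneg (α := ℝ) (6 • B' - 6 • B').card) hn'.le
      refine le_trans ?_ hk
      generalize ((6 • B' - 6 • B').card : ℝ) / B'.card = r at h1 h2 ⊢
      gcongr
    obtain ⟨t, ht, hprog⟩ := exists_progression_subset hB' hratio hL0 hlt
    obtain ⟨x, hx⟩ := exists_translate_dense hB' (by positivity) hfive ht hprog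
    refine ⟨L + 1, _, isArithmeticProgression_image ht x (L + 1), ?_, ?_⟩
    · push_cast
      exact hroot.trans (Nat.lt_floor_add_one _).le
    · have h1 : (((Finset.range (L + 1)).image fun j : ℕ => x - (j : ℤ) * t).card : ℝ)
          ≤ ((L + 1 : ℕ) : ℝ) := by
        have := Finset.card_image_le (s := Finset.range (L + 1)) (f := fun j : ℕ => x - (j : ℤ) * t)
        rw [Finset.card_range] at this
        exact_mod_cast this
      calc _ ≤ 1 / C ^ 5 * ((L + 1 : ℕ) : ℝ) := mul_le_mul hc3 h1 (Nat.cast_nonneg _) (by positivity)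
        _ ≤ _ := hx
        _ ≤ _ := by exact_mod_cast Finset.card_le_card (Finset.inter_subset_inter_right hB'B)

end

theorem corollary1p3 :
    ∃ N₀ : ℕ, ∀ K : ℝ, 0 < K → ∃ c : ℝ, 0 < c ∧
      ∀ N : ℕ, 0 < N → N₀ ≤ N → ∀ A : Finset ℤ, A.card = N →
        fourierL1Norm A ≤ K * Real.log (N : ℝ) →
        ∃ (L : ℕ) (P : Finset ℤ), IsArithmeticProgression P L ∧
          (N : ℝ) ^ c ≤ (L : ℝ) ∧ c * (P.card : ℝ) ≤ ((A ∩ P).card : ℝ) := by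
  refine ⟨4, fun K hK => ?_⟩
  obtain ⟨c, hc, hprog⟩ := exists_progression_of_addEnergy
    (ε := 1 / (14400 * K ^ 2)) (by positivity)
  refine ⟨c / 4, by positivity, ?_⟩
  rintro N - hN A rfl hnorm
  obtain ⟨B, hBA, hB, hcard, hE⟩ := exists_subset_le_addEnergy hK hN hnorm
  obtain ⟨L, P, hP, hL, hBP⟩ := hprog B hB hE
  refine ⟨L, P, hP, le_trans ?_ hL, ?_⟩
  · calc (A.card : ℝ) ^ (c / 4) ≤ ((B.card : ℝ) ^ (4 : ℝ)) ^ (c / 4) := by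
          refine Real.rpow_le_rpow (Nat.cast_nonneg _) ?_ (by positivity)
          exact_mod_cast hcard
      _ = (B.card : ℝ) ^ c := by
          rw [← Real.rpow_mul (Nat.cast_nonneg _)]; congr 1; ring
  · have h1 : ((B ∩ P).card : ℝ) ≤ (A ∩ P).card := by
      exact_mod_cast Finset.card_le_card (Finset.inter_subset_inter_right hBA)
    have h2 : c / 4 * (P.card : ℝ) ≤ c * P.card :=
      mul_le_mul_of_nonneg_right (by linarith) (Nat.cast_nonneg _)
    linarith
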